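/- Let $n\in\{2,3\}$, $\epsilon>0$, let $\Omega\subset\mathbb{R}^n$ be a bounded domain (open, connected), let $\Omega_d\subset\Omega$ be a measurable set of positive volume, and put $D=\Omega\setminus\Omega_d$. Assume the interior cone condition at the points of $D$: there is a finite cone such that every $x\in D$ is the vertex of a congruent cone contained in $\Omega$. (This is automatic if $\Omega_d$ is a collar of thickness $\epsilon$, i.e. if $H_\epsilon(x)=\{y:|y-x|<\epsilon\}\subset\Omega$ for all $x\in D$.) Let $J\ge 0$ be a bounded measurable function that is zero outside $[0,1]$ and has $0$ in its essential support, i.e. $J$ is not almost everywhere zero on any interval $(0,\delta)$. Let $g:\mathbb{R}\to\mathbb{R}$ be three times differentiable with $g,g',g'',g'''$ bounded, $g(0)=0$, $g(r)>0$ for $r\neq0$, $g$ convex on $[r^e,r^c]$ for some $r^e<0<r^c$ and concave on $(-\infty,r^e]$ and on $[r^c,\infty)$, with finite limits at $\pm\infty$, and with $\max|g''|=g''(0)$. Write $e_{h}=h/|h|$, $S(y,x,u)=\frac{u(y)-u(x)}{|y-x|}\cdot e_{y-x}$, let $\omega_n$ be the volume of the unit ball, and for an indicator function $\chi$ of intact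 bonds let $$\mathcal{L}_\chi[u](x)=-\int_{H_\epsilon(x)\cap\Omega}2\,\chi(y,x)\frac{J(|y-x|/\epsilon)}{\epsilon^{n+1}\omega_n\sqrt{|y-x|}}\,g'\big(\sqrt{|y-x|}\,S(y,x,u)\big)\,e_{y-x}\,dy,\qquad x\in D,$$ extended by $0$ to $\Omega_d$; write $\mathcal{L}=\mathcal{L}_1$ for $\chi\equiv1$. Let $$\mathcal{L}'[u]w(x)=-\int_{H_\epsilon(x)\cap\Omega}2\frac{J(|y-x|/\epsilon)}{\epsilon^{n+1}\omega_n}g''\big(\sqrt{|y-x|}\,S(y,x,u)\big)S(y,x,w)\,e_{y-x}\,dy,\qquad x\in D,$$ extended by $0$ to $\Omega_d$, and let the stability tensor be $$\mathbb{A}[u](x)=\int_{H_\epsilon(x)\cap\Omega}\frac{J(|y-x|/\epsilon)}{\epsilon^{n+1}\omega_n|y-x|}g''\big(\sqrt{|y-x|}\,S(y,x,u)\big)\,e_{y-x}\otimes e_{y-x}\,dy .$$ Let $\mathcal{V}=\{v\in L^\infty(\Omega,\mathbb{R}^n): v=0 \text{ a.e. on }\Omega_d\}$ and $\mathcal{B}=\{U\in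 L^\infty(\Omega,\mathbb{R}^n): U=0\text{ a.e. on }D\}$, with the norm $\|\cdot\|_\infty$. Equations on $D$ are understood almost everywhere. Then: 1. $\mathcal{L}$ maps $\mathcal{V}$ into $\mathcal{V}$ and is Fréchet differentiable at $u^0=0$ with derivative $\mathcal{L}'[0]$, and $\mathcal{L}'[0]$ is a bounded linear bijection of $\mathcal{V}$ onto $\mathcal{V}$ whose inverse is bounded. 2. There is $R>0$ such that, among all $u\in\mathcal{V}$ with $\|u\|_\infty<R$, the function $u^0=0$ is the unique solution of $\mathcal{L}[u]=0$ on $D$, $u=0$ on $\Omega_d$. 3. The hypotheses of the load increment step hold at $u^0=0$: $\mathcal{L}[0]=0$ on $D$; there is $\gamma>0$ with $\mathbb{A}[0](x)^2v\cdot v>\gamma^2|v|^2$ for all $x\in D$ and $0\neq v\in\mathbb{R}^n$; and the only $w\in L^2(\Omega,\mathbb{R}^n)$ with $w=0$ a.e. on $\Omega_d$ and $\mathcal{L}'[0]w=0$ a.e. is $w=0$. 4. Hence the evolution can be initialized: with $R$ as in 2 there is $\delta>0$ such that for every $U\in\mathcal{B}$ with $\|U\|_\infty<\delta$ (and there are nonzero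 such $U$) there is exactly one $v\in\mathcal{V}$ with $\|v\|_\infty<R$ for which $u^1=v+U$ satisfies $\mathcal{L}[u^1]=0$ on $D$. Moreover $\mathcal{L}_{\chi_1}[u^1]=0$ on $D$, where $\chi_1$ is obtained from $\chi\equiv 1$ by deleting all broken bonds, i.e. all pairs $(y,x)$ for which $r=\sqrt{|y-x|}\,S(y,x,u^1)$ satisfies $g'(r)=0$ and ($r<r^e$ or $r>r^c$). -/

import Mathlib

open MeasureTheory Set Filter Topology
open scoped ENNReal

noncomputable section

namespace NonlocalFracture

/-- Euclidean space `ℝⁿ`. -/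
abbrev Space (n : ℕ) : Type := EuclideanSpace ℝ (Fin n)

/-- The data of the nonlocal model: the horizon `ε`, the domain `Ω`, the interaction domain `Ωd`
(where displacements are prescribed), the influence function `J`, the potential `g`, and the strains
`re < 0 < rc` between which `g` is convex. -/
structure Model (n : ℕ) where
  ε : ℝ
  Ω : Set (Space n)
  Ωd : Set (Space n)
  J : ℝ → ℝ
  g : ℝ → ℝ
  re : ℝ
  rc : ℝ

/-- The hypotheses on the potential `g`: it is three times differentiable, `g, g', g'', g'''` are
bounded, `g 0 = 0` and `g > 0` elsewhere, `g` is convex on `[re, rc]` with `re < 0 < rc` and concave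
on either side of that interval, it has finite limits at `±∞`, and `max |g''| = g''(0)`. -/
structure IsCohesivePotential (g : ℝ → ℝ) (re rc : ℝ) : Prop where
  differentiable : ∀ k < 3, Differentiable ℝ (iteratedDeriv k g)
  bounded : ∀ k ≤ 3, ∃ C : ℝ, ∀ r : ℝ, |iteratedDeriv k g r| ≤ C
  zero : g 0 = 0
  pos : ∀ r : ℝ, r ≠ 0 → 0 < g r
  re_neg : re < 0
  rc_pos : 0 < rc
  convex : ConvexOn ℝ (Icc re rc) g
  concave_left : ConcaveOn ℝ (Iic re) g
  concave_right : ConcaveOn ℝ (Ici rc) g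
  limit_left : ∃ C : ℝ, Tendsto g atBot (𝓝 C)
  limit_right : ∃ C : ℝ, Tendsto g atTop (𝓝 C)
  max_second : ∀ r : ℝ, |iteratedDeriv 2 g r| ≤ iteratedDeriv 2 g 0

/-- The hypotheses on the influence function `J`: measurable, nonnegative, bounded, zero outside
`[0,1]`, and with `0` in its essential support (`J` is not almost everywhere zero on any `(0, δ)`). -/
structure IsInfluenceFunction (J : ℝ → ℝ) : Prop where
  measurable : Measurable J
  nonneg : ∀ r : ℝ, 0 ≤ J r
  bounded : ∃ C : ℝ, ∀ r : ℝ, J r ≤ C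
  zero_outside : ∀ r : ℝ, r ∉ Icc (0 : ℝ) 1 → J r = 0
  zero_mem_support : ∀ δ : ℝ, 0 < δ → 0 < volume {r : ℝ | r ∈ Ioo 0 δ ∧ 0 < J r}

/-- Interior cone condition for `Ω` at the points of `X`: there is a finite cone (height `ρ`, cosine
of the half-angle `κ`) such that every `x ∈ X` is the vertex of a congruent cone inside `Ω`. -/
def InteriorConeCondition {n : ℕ} (Ω X : Set (Space n)) : Prop :=
  ∃ κ ρ : ℝ, κ < 1 ∧ 0 < ρ ∧ ∀ x ∈ X, ∃ ξ : Space n, ‖ξ‖ = 1 ∧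
    ∀ y : Space n, 0 < ‖y - x‖ → ‖y - x‖ < ρ → κ * ‖y - x‖ < inner ℝ (y - x) ξ → y ∈ Ω

/-- The unit vector `e_h = h / |h|` (and `0` for `h = 0`). -/
def unitVec {n : ℕ} (h : Space n) : Space n := ‖h‖⁻¹ • h

/-- The nonlocal strain `S(y, x, u) = (u(y) - u(x)) / |y - x| ⬝ e_{y-x}`. -/
def strain {n : ℕ} (u : Space n → Space n) (y x : Space n) : ℝ :=
  inner ℝ (‖y - x‖⁻¹ • (u y - u x)) (unitVec (y - x))

/-- The scaled strain `√|y-x| S(y, x, u)`. -/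
def scaledStrain {n : ℕ} (u : Space n → Space n) (y x : Space n) : ℝ :=
  Real.sqrt ‖y - x‖ * strain u y x

/-- The volume `ω_n` of the unit ball of `ℝⁿ`. -/
def unitBallVolume (n : ℕ) : ℝ := volume.real (Metric.ball (0 : Space n) 1)

namespace Model

variable {n : ℕ} (M : Model n)

/-- The cracking body `D = Ω \ Ωd`. -/
def D : Set (Space n) := M.Ω \ M.Ωd

/-- Standing assumptions of the model. -/
structure Admissible : Prop where
  ε_pos : 0 < M.ε
  isOpen : IsOpen M.Ω
  isConnected : IsConnected M.Ω
  isBounded : Bornology.IsBounded M.Ω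
  subset : M.Ωd ⊆ M.Ω
  measurableSet : MeasurableSet M.Ωd
  volume_pos : 0 < volume M.Ωd
  cone : InteriorConeCondition M.Ω M.D
  influence : IsInfluenceFunction M.J
  potential : IsCohesivePotential M.g M.re M.rc

/-- The weight `J(|y-x| / ε) / (ε^(n+1) ω_n)`. -/
def weight (y x : Space n) : ℝ :=
  M.J (‖y - x‖ / M.ε) / (M.ε ^ (n + 1) * unitBallVolume n)

/-- The nonlocal force density at `x ∈ D` for the indicator function `χ` of the intact bonds. -/
def forceDensity (χ : Space n → Space n → ℝ) (u : Space n → Space n) (x : Space n) : Space n :=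
  -∫ y in Metric.ball x M.ε ∩ M.Ω,
    (2 * χ y x * (M.weight y x / Real.sqrt ‖y - x‖) * deriv M.g (scaledStrain u y x)) •
      unitVec (y - x)

/-- Initially all bonds are intact: `χ₀ = 1`. -/
def initialBonds : Space n → Space n → ℝ := fun _ _ => 1

/-- The bond between `y` and `x` is broken by the displacement `u`: the scaled strain lies outside
`[re, rc]` and the bond carries no force. -/
def Broken (u : Space n → Space n) (y x : Space n) : Prop :=
  deriv M.g (scaledStrain u y x) = 0 ∧
    (scaledStrain u y x < M.re ∨ M.rc < scaledStrain u y x)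

open Classical in
/-- The bonds that remain of `χ` when those broken by `u` are deleted. -/
def remainingBonds (χ : Space n → Space n → ℝ) (u : Space n → Space n) :
    Space n → Space n → ℝ :=
  fun y x => if M.Broken u y x then 0 else χ y x

/-- The operator `𝓛[u]` with bonds `χ`: the force density on `D`, extended by `0`. -/
def L (χ : Space n → Space n → ℝ) (u : Space n → Space n) : Space n → Space n :=
  M.D.indicator (M.forceDensity χ u)

/-- The linearized operator `𝓛'[u] w` of the intact body, extended by `0` outside `D`. -/
def L' (u w : Space n → Space n) : Space n → Space n :=
  M.D.indicator fun x =>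
    -∫ y in Metric.ball x M.ε ∩ M.Ω,
      (2 * M.weight y x * iteratedDeriv 2 M.g (scaledStrain u y x) * strain w y x) •
        unitVec (y - x)

/-- The stability tensor `𝔸[u](x)`. -/
def stabilityTensor (u : Space n → Space n) (x : Space n) : Matrix (Fin n) (Fin n) ℝ :=
  Matrix.of fun i j => ∫ y in Metric.ball x M.ε ∩ M.Ω,
    M.weight y x / ‖y - x‖ * iteratedDeriv 2 M.g (scaledStrain u y x) *
      (unitVec (y - x) i * unitVec (y - x) j)

/-- Lebesgue measure on `Ω`. -/
abbrev μ : Measure (Space n) := volume.restrict M.Ω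

/-- The space `L^p(Ω, ℝⁿ)`. -/
abbrev Displacement (p : ℝ≥0∞) : Type := Lp (Space n) p M.μ

/-- The elements of `L^p(Ω, ℝⁿ)` that vanish almost everywhere on `A`. -/
def vanishingOn (p : ℝ≥0∞) (A : Set (Space n)) : Submodule ℝ (M.Displacement p) where
  carrier := {v | ∀ᵐ x ∂M.μ, x ∈ A → v x = 0}
  zero_mem' := by
    filter_upwards [Lp.coeFn_zero (Space n) p M.μ] with x hx _
    simpa using hx
  add_mem' := by
    intro v w hv hw
    filter_upwards [hv, hw, Lp.coeFn_add v w] with x h1 h2 h3 hx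
    rw [h3, Pi.add_apply, h1 hx, h2 hx, add_zero]
  smul_mem' := by
    intro c v hv
    filter_upwards [hv, Lp.coeFn_smul c v] with x h1 h2 hx
    rw [h2, Pi.smul_apply, h1 hx, smul_zero]

/-- The space `𝓥` of displacements in `L^∞(Ω, ℝⁿ)` that are zero on `Ωd`. -/
abbrev V : Submodule ℝ (M.Displacement ∞) := M.vanishingOn ∞ M.Ωd

/-- The space `𝓑` of boundary displacements: elements of `L^∞(Ω, ℝⁿ)` that are zero on `D`. -/
abbrev B : Submodule ℝ (M.Displacement ∞) := M.vanishingOn ∞ M.D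

/-- `𝓛[u](x) = 0` for (almost every) `x` in `D`, with bonds `χ`. -/
def IsEquilibrium (χ : Space n → Space n → ℝ) (u : M.Displacement ∞) : Prop :=
  ∀ᵐ x ∂M.μ, x ∈ M.D → M.L χ u x = 0

end Model

end NonlocalFracture

end

open NonlocalFracture

/-!
Write `e_h = h/|h|` and let `k(h) = g''(0) J(|h|/ε) / (ε^(n+1) ω_n |h|) e_h ⊗ e_h` be the stiffness of
an unstrained bond. The linearized operator at `0` is `2 (N - K)`, where `N` is multiplication by the
total stiffness `∫_Ω k(y - x) dy` and `K w (x) = ∫_Ω k(y - x) w(y) dy`; both are cut off to `D`.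
Since `k` is of order `|h|⁻¹`, it is integrable in dimension at least two.

* `N` is invertible: by the cone condition the total stiffness is coercive uniformly on `D`
  (`exists_coercive`), so `1 - τ N` is a contraction for some `τ > 0`. The same estimate bounds the
  square of the stability tensor from below (`exists_stabilityTensor_sq`).
* `K` is compact, as a convolution with an integrable kernel (`isCompactOperator_of_kernel`), and the
  Fredholm alternative reduces bijectivity of `N - K` to injectivity.
* Injectivity holds even on `L²` (`ae_eq_zero_of_L'_zero`). Testing `𝓛'[0] w = 0` with `w` and
  symmetrizing the double integral gives `(w(y) - w(x)) ⬝ (y - x) = 0` for almost all bonds of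
  positive weight. As arbitrarily short bonds have positive weight, the mollifications of `w` have
  zero symmetrized gradient, so that `w` stretches no bond at all inside small balls. Such a field
  vanishes on a whole ball as soon as it vanishes on a nonnull part of it; connectedness of `Ω`
  propagates this from `Ωd` (`ae_eq_zero_of_inner_sub_eq_zero`).
* The remainder `𝓛[u] - 𝓛[v] - 𝓛'[0](u - v)` is at most `C max(‖u‖, ‖v‖) ‖u - v‖`
  (`exists_forceOperator`): since `g''` is Lipschitz, the remainder of a bond has a kernel of order
  `|h|^{-3/2}`, again integrable. Differentiability, local uniqueness and solvability for small loads
  follow by the contraction principle (`exists_unique_zero_of_quadratic_deviation`).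
-/

noncomputable section

namespace NonlocalFracture

/-! ### The potential near the origin -/

namespace IsCohesivePotential

variable {g : ℝ → ℝ} {re rc : ℝ}

lemma hasDerivAt_deriv (hg : IsCohesivePotential g re rc) (r : ℝ) :
    HasDerivAt (deriv g) (iteratedDeriv 2 g r) r := by
  have h := (hg.differentiable 1 (by norm_num) r).hasDerivAt
  rwa [← iteratedDeriv_succ, iteratedDeriv_one] at h

lemma hasDerivAt_second (hg : IsCohesivePotential g re rc) (r : ℝ) :
    HasDerivAt (iteratedDeriv 2 g) (iteratedDeriv 3 g r) r := by
  have h := (hg.differentiable 2 (by norm_num) r).hasDerivAt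
  rwa [← iteratedDeriv_succ] at h

lemma deriv_zero (hg : IsCohesivePotential g re rc) : deriv g 0 = 0 := by
  apply IsLocalMin.deriv_eq_zero
  refine Eventually.of_forall fun r => ?_
  rw [hg.zero]
  rcases eq_or_ne r 0 with rfl | h
  · exact hg.zero.ge
  · exact (hg.pos r h).le

/-- If `g''(0)` vanished, so would `g''`, and `g' = g'(0) = 0` would make `g` constant. -/
lemma second_pos (hg : IsCohesivePotential g re rc) : 0 < iteratedDeriv 2 g 0 := by
  have h0 : 0 ≤ iteratedDeriv 2 g 0 := (abs_nonneg _).trans (hg.max_second 0)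
  refine lt_of_le_of_ne h0 fun h => ?_
  have h2 : ∀ r, iteratedDeriv 2 g r = 0 := fun r => by
    simpa [← h] using hg.max_second r
  have h1 : ∀ r, deriv g r = 0 := fun r => by
    rw [← hg.deriv_zero]
    exact is_const_of_deriv_eq_zero (fun r => (hg.hasDerivAt_deriv r).differentiableAt)
      (fun r => by rw [(hg.hasDerivAt_deriv r).deriv, h2]) r 0
  have h3 : g 1 = g 0 := is_const_of_deriv_eq_zero
    (by simpa using hg.differentiable 0 (by norm_num)) h1 1 0
  have := hg.pos 1 one_ne_zero
  rw [h3, hg.zero] at this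
  exact this.false

lemma abs_deriv_le (hg : IsCohesivePotential g re rc) (r : ℝ) :
    |deriv g r| ≤ iteratedDeriv 2 g 0 * |r| := by
  have := Convex.norm_image_sub_le_of_norm_hasDerivWithin_le (s := univ) (x := 0) (y := r)
    (fun x _ => (hg.hasDerivAt_deriv x).hasDerivWithinAt)
    (fun x _ => by simpa using hg.max_second x) convex_univ (mem_univ _) (mem_univ _)
  simpa [hg.deriv_zero] using this

/-- `g'` is strictly differentiable at `0`, with a quantitative (Lipschitz) remainder. -/
lemma exists_linearization_bound (hg : IsCohesivePotential g re rc) :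
    ∃ C : ℝ, 0 ≤ C ∧ ∀ m r s : ℝ, |r| ≤ m → |s| ≤ m →
      |deriv g r - deriv g s - iteratedDeriv 2 g 0 * (r - s)| ≤ C * m * |r - s| := by
  obtain ⟨C, hC⟩ := hg.bounded 3 le_rfl
  have hC0 : 0 ≤ C := (abs_nonneg _).trans (hC 0)
  refine ⟨C, hC0, fun m r s hr hs => ?_⟩
  have h2 : ∀ x ∈ Icc (-m) m, ‖iteratedDeriv 2 g x - iteratedDeriv 2 g 0‖ ≤ C * m := by
    intro x hx
    have := Convex.norm_image_sub_le_of_norm_hasDerivWithin_le (s := univ) (x := 0) (y := x)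
      (fun x _ => (hg.hasDerivAt_second x).hasDerivWithinAt)
      (fun x _ => hC x) convex_univ (mem_univ _) (mem_univ _)
    refine this.trans ?_
    rw [sub_zero, Real.norm_eq_abs]
    exact mul_le_mul_of_nonneg_left (abs_le.2 hx) hC0
  have := Convex.norm_image_sub_le_of_norm_hasDerivWithin_le (s := Icc (-m) m) (x := s) (y := r)
    (f := fun x => deriv g x - iteratedDeriv 2 g 0 * x)
    (f' := fun x => iteratedDeriv 2 g x - iteratedDeriv 2 g 0)
    (fun x _ => by
      have h := (hg.hasDerivAt_deriv x).sub ((hasDerivAt_id x).const_mul (iteratedDeriv 2 g 0))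
      rw [mul_one] at h
      exact h.hasDerivWithinAt)
    h2 (convex_Icc _ _) (abs_le.1 hs) (abs_le.1 hr)
  refine le_trans (le_of_eq ?_) this
  rw [Real.norm_eq_abs]
  congr 1
  ring

end IsCohesivePotential

/-! ### Weakly singular kernels and cones -/

/-- `|h|^p` is integrable near the origin for `p > -2`, in every dimension `n ≥ 2`; the
exponents in use are `-1` and `-3/2`. -/
lemma integrableOn_ball_rpow_norm {n : ℕ} (hn : 2 ≤ n) {p : ℝ} (hp : -2 < p) (R : ℝ) :
    IntegrableOn (fun h : Space n => ‖h‖ ^ p) (Metric.ball 0 R) := by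
  have : Nontrivial (Space n) := by
    have : Nonempty (Fin n) := ⟨⟨0, by omega⟩⟩
    infer_instance
  rw [integrableOn_fun_norm_addHaar volume (f := fun r : ℝ => r ^ p), finrank_euclideanSpace,
    Fintype.card_fin]
  have h1 : ∀ y ∈ Ioo (0 : ℝ) R, y ^ (n - 1) • y ^ p = y ^ (((n - 1 : ℕ) : ℝ) + p) := by
    intro y hy
    rw [smul_eq_mul, Real.rpow_add hy.1, Real.rpow_natCast]
  rw [integrableOn_congr_fun h1 measurableSet_Ioo]
  rcases le_or_gt R 0 with hR | hR
  · simp [Ioo_eq_empty_of_le hR]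
  · rw [intervalIntegral.integrableOn_Ioo_rpow_iff hR]
    have : (1 : ℝ) ≤ ((n - 1 : ℕ) : ℝ) := by exact_mod_cast (by omega : 1 ≤ n - 1)
    linarith

/-- In polar coordinates a cone with radii in a set of positive length is a product of sets of
positive measure. -/
lemma volume_cone_pos {n : ℕ} {s : Set ℝ} (hs : MeasurableSet s) (hs0 : s ⊆ Ioi 0)
    (hvol : 0 < volume s) {κ : ℝ} (hκ : κ < 1) {ξ : Space n} (hξ : ‖ξ‖ = 1) :
    0 < volume {h : Space n | ‖h‖ ∈ s ∧ κ * ‖h‖ < inner ℝ h ξ} := by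
  have : Nontrivial (Space n) := ⟨ξ, 0, by rintro rfl; simp at hξ⟩
  set S : Set (Metric.sphere (0 : Space n) 1) := {e | κ < inner ℝ (e : Space n) ξ}
  have hS : IsOpen S := isOpen_lt continuous_const (by fun_prop)
  have hSpos : 0 < (volume : Measure (Space n)).toSphere S :=
    hS.measure_pos _ ⟨⟨ξ, by simp [hξ]⟩, by simp [S, hξ, hκ]⟩
  set I : Set (Ioi (0 : ℝ)) := Subtype.val ⁻¹' s
  have hI : MeasurableSet I := measurable_subtype_coe hs
  have hIpos : 0 < Measure.volumeIoiPow (Module.finrank ℝ (Space n) - 1) I := by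
    rw [Measure.volumeIoiPow, pos_iff_ne_zero, Ne, withDensity_apply_eq_zero' (by fun_prop)]
    intro h
    have h2 : {x : Ioi (0 : ℝ) | ENNReal.ofReal (x.1 ^ (Module.finrank ℝ (Space n) - 1)) ≠ 0} ∩ I
        = I := by
      apply inter_eq_right.2
      intro x _
      have := x.2
      simp only [mem_ofPred_eq, ne_eq, ENNReal.ofReal_eq_zero, not_le]
      exact pow_pos this _
    rw [h2, comap_subtype_coe_apply measurableSet_Ioi, Subtype.image_preimage_coe,
      inter_eq_right.2 hs0] at h
    exact hvol.ne' h
  have hmp := (volume : Measure (Space n)).measurePreserving_homeomorphUnitSphereProd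
  have key := hmp.measure_preimage (s := S ×ˢ I) (hS.measurableSet.prod hI).nullMeasurableSet
  rw [Measure.prod_prod, comap_subtype_coe_apply (measurableSet_singleton _).compl] at key
  refine lt_of_lt_of_le (ENNReal.mul_pos hSpos.ne' hIpos.ne') (key ▸ measure_mono ?_)
  rintro _ ⟨h, ⟨h1, h2⟩, rfl⟩
  have hn : 0 < ‖(h : Space n)‖ := norm_pos_iff.2 h.2
  have h2' : ‖(h : Space n)‖ ∈ s := by simpa [I] using h2
  refine ⟨h2', ?_⟩
  have h1' : κ < inner ℝ (‖(h : Space n)‖⁻¹ • (h : Space n)) ξ := by simpa [S] using h1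
  rwa [real_inner_smul_left, inv_mul_eq_div, lt_div_iff₀ hn] at h1'

/-! ### A compactness criterion -/

/-- An operator that is controlled, up to arbitrarily small multiples of the norm, by finitely many
operators of finite rank is compact: its image of the unit ball is totally bounded. -/
lemma isCompactOperator_of_le_finite {α E F G : Type*} [NormedAddCommGroup E]
    [NormedSpace ℝ E] [NormedAddCommGroup F] [NormedSpace ℝ F] [CompleteSpace F]
    [NormedAddCommGroup G] [NormedSpace ℝ G] [FiniteDimensional ℝ G] (T : E →L[ℝ] F)
    (h : ∀ δ : ℝ, 0 < δ → ∃ (t : Finset α) (S : α → E →L[ℝ] G),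
      ∀ (w : E) (c : ℝ), 0 ≤ c → (∀ i ∈ t, ‖S i w‖ ≤ c) → ‖T w‖ ≤ c + δ * ‖w‖) :
    IsCompactOperator T := by
  rw [show (T : E → F) = ((T : E →ₗ[ℝ] F) : E → F) from rfl,
    isCompactOperator_iff_isCompact_closure_image_ball _ one_pos]
  refine TotallyBounded.isCompact_of_isClosed (TotallyBounded.closure ?_) isClosed_closure
  rw [Metric.totallyBounded_iff]
  intro ε hε
  obtain ⟨t, S, hS⟩ := h (ε / 8) (by positivity)
  set P : E →L[ℝ] (t → G) := ContinuousLinearMap.pi fun i : t => S i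
  have : ProperSpace (t → G) := FiniteDimensional.proper ℝ _
  have hb : Bornology.IsBounded (P '' Metric.ball 0 1) :=
    P.lipschitz.isBounded_image Metric.isBounded_ball
  have hP : TotallyBounded (P '' Metric.ball 0 1) :=
    hb.isCompact_closure.totallyBounded.subset subset_closure
  obtain ⟨y, hys, hyf, hy⟩ := Metric.finite_approx_of_totallyBounded hP (ε / 2) (by positivity)
  choose! f hf using fun z (hz : z ∈ y) => hys hz
  refine ⟨(fun z => T (f z)) '' y, hyf.image _, ?_⟩
  rintro _ ⟨w, hw, rfl⟩
  obtain ⟨z, hz, hwz⟩ := mem_iUnion₂.1 (hy (mem_image_of_mem P hw))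
  refine mem_iUnion₂.2 ⟨_, mem_image_of_mem _ hz, ?_⟩
  rw [Metric.mem_ball, dist_eq_norm] at hwz ⊢
  rw [← (hf z hz).2, ← map_sub] at hwz
  have hfz := (hf z hz).1
  rw [mem_ball_zero_iff] at hw hfz
  have h1 : ‖w - f z‖ < 2 := (norm_sub_le _ _).trans_lt (by linarith)
  have := hS (w - f z) (ε / 2) (by positivity) fun i hi =>
    (norm_le_pi_norm (P (w - f z)) ⟨i, hi⟩).trans hwz.le
  calc ‖T w - T (f z)‖ = ‖T (w - f z)‖ := by rw [map_sub]
    _ ≤ ε / 2 + ε / 8 * ‖w - f z‖ := this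
    _ < ε := by nlinarith

/-! ### Fields that do not stretch short bonds -/

variable {n : ℕ}

/-- A field whose increments over short bonds, of lengths in a set `s` accumulating (in measure) at
`0`, are orthogonal to the bond has vanishing symmetrized gradient. -/
lemma inner_fderiv_self_eq_zero {s : Set ℝ} (hs : MeasurableSet s) (hs0 : s ⊆ Ioi 0)
    (hsv : ∀ δ : ℝ, 0 < δ → 0 < volume (s ∩ Iio δ)) {f : Space n → Space n} {x : Space n}
    {D : Space n →L[ℝ] Space n} (hf : HasFDerivAt f D x) {r : ℝ} (hr : 0 < r)
    (h : ∀ᵐ h : Space n, ‖h‖ < r → ‖h‖ ∈ s → inner ℝ (f (x + h) - f x) h = 0) (v : Space n) :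
    inner ℝ (D v) v = 0 := by
  suffices H : ∀ e : Space n, ‖e‖ = 1 → inner ℝ (D e) e = 0 by
    rcases eq_or_ne v 0 with rfl | hv
    · simp
    · have := H (‖v‖⁻¹ • v) (by
        rw [norm_smul, norm_inv, norm_norm, inv_mul_cancel₀ (norm_ne_zero_iff.2 hv)])
      rw [map_smul, real_inner_smul_left, real_inner_smul_right] at this
      have hn : ‖v‖⁻¹ ≠ 0 := inv_ne_zero (norm_ne_zero_iff.2 hv)
      exact (mul_eq_zero.1 ((mul_eq_zero.1 this).resolve_left hn)).resolve_left hn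
  intro e he
  by_contra hc
  set c := |inner ℝ (D e) e| with hcdef
  have hc0 : 0 < c := abs_pos.2 hc
  have hcont : Continuous fun e' : Space n => |inner ℝ (D e') e'| := by fun_prop
  have hopen : {e' : Space n | c / 2 < |inner ℝ (D e') e'|} ∈ 𝓝 e :=
    (isOpen_lt continuous_const hcont).mem_nhds (by simp only [mem_ofPred_eq]; linarith)
  obtain ⟨η, hη, hηs⟩ := Metric.mem_nhds_iff.1 hopen
  have hlittle := (hasFDerivAt_iff_isLittleO_nhds_zero.1 hf).def (c := c / 4) (by positivity)
  obtain ⟨δ, hδ, hδs⟩ := Metric.eventually_nhds_iff.1 hlittle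
  -- the cone around `e` of directions at distance less than `η` from `e`
  have hpos := volume_cone_pos (s := s ∩ Iio (min δ r)) (hs.inter measurableSet_Iio)
    (inter_subset_left.trans hs0) (hsv _ (lt_min hδ hr)) (κ := 1 - η ^ 2 / 2)
    (by nlinarith [sq_pos_of_pos hη]) he
  obtain ⟨h, ⟨⟨h1, h2⟩, h3⟩, h4⟩ :=
    ((frequently_ae_iff.2 hpos.ne').and_eventually h).exists
  have h2 : ‖h‖ < min δ r := h2
  have hn : 0 < ‖h‖ := hs0 h1
  have horth := h4 (h2.trans_le (min_le_right _ _)) h1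
  have hsmall := hδs (y := h) (by simpa using h2.trans_le (min_le_left _ _))
  have hdir : c / 2 < |inner ℝ (D (‖h‖⁻¹ • h)) (‖h‖⁻¹ • h)| := by
    apply hηs
    rw [mem_ball_iff_norm]
    have hh : ‖‖h‖⁻¹ • h‖ = 1 := by
      rw [norm_smul, norm_inv, norm_norm, inv_mul_cancel₀ hn.ne']
    have h5 : ‖‖h‖⁻¹ • h - e‖ ^ 2 < η ^ 2 := by
      rw [norm_sub_sq_real, hh, he, real_inner_smul_left]
      have : 1 - η ^ 2 / 2 < ‖h‖⁻¹ * inner ℝ h e := by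
        rw [inv_mul_eq_div, lt_div_iff₀ hn]; exact h3
      linarith
    exact lt_of_pow_lt_pow_left₀ 2 hη.le h5
  rw [map_smul, real_inner_smul_left, real_inner_smul_right, abs_mul, abs_mul,
    abs_of_pos (inv_pos.2 hn)] at hdir
  have hup : |inner ℝ (D h) h| ≤ c / 4 * ‖h‖ * ‖h‖ := by
    have : inner ℝ (D h) h = - inner ℝ (f (x + h) - f x - D h) h := by
      rw [inner_sub_left _ (D h), horth]; ring
    rw [this, abs_neg]
    exact (abs_real_inner_le_norm _ _).trans (mul_le_mul_of_nonneg_right hsmall hn.le)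
  have h6 : ‖h‖⁻¹ * (‖h‖⁻¹ * |inner ℝ (D h) h|) ≤ c / 4 := by
    rw [inv_mul_le_iff₀ hn, inv_mul_le_iff₀ hn]; linarith
  linarith

/-- If the symmetrized gradient vanishes on a convex set, the field does not stretch any bond
between points of that set. -/
lemma inner_sub_eq_zero_of_inner_fderiv {f : Space n → Space n} (hf : Differentiable ℝ f)
    {B : Set (Space n)} (hB : Convex ℝ B) (h : ∀ x ∈ B, ∀ v, inner ℝ (fderiv ℝ f x v) v = 0)
    {x y : Space n} (hx : x ∈ B) (hy : y ∈ B) : inner ℝ (f y - f x) (y - x) = 0 := by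
  obtain ⟨z, hz, hz'⟩ := domain_mvt (f := fun z => inner ℝ (y - x) (f z))
    (f' := fun z => (innerSL ℝ (y - x)).comp (fderiv ℝ f z)) (s := B)
    (fun z _ => ((innerSL ℝ (y - x)).hasFDerivAt.comp z (hf z).hasFDerivAt).hasFDerivWithinAt)
    hB hx hy
  rw [real_inner_comm, inner_sub_right, hz']
  have := h z (hB.segment_subset hx hy hz) (y - x)
  rw [real_inner_comm] at this
  exact this

/-- Locally, a field that does not stretch the bonds of lengths in `s` does not stretch any bond.
The field is mollified to make the preceding two lemmas applicable. -/
lemma exists_ball_inner_sub_eq_zero {s : Set ℝ} (hs : MeasurableSet s) (hs0 : s ⊆ Ioi 0)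
    (hsv : ∀ δ : ℝ, 0 < δ → 0 < volume (s ∩ Iio δ)) {Ω : Set (Space n)} (hΩ : IsOpen Ω)
    {f : Space n → Space n} (hfm : StronglyMeasurable f) (hfi : Integrable f)
    (h : ∀ᵐ x : Space n, ∀ᵐ y : Space n, x ∈ Ω → y ∈ Ω → ‖y - x‖ ∈ s →
      inner ℝ (f y - f x) (y - x) = 0) {x₀ : Space n} (hx₀ : x₀ ∈ Ω) :
    ∃ r : ℝ, 0 < r ∧ ∃ G : Set (Space n), (∀ᵐ x, x ∈ G) ∧
      ∀ x ∈ G ∩ Metric.ball x₀ r, ∀ y ∈ G ∩ Metric.ball x₀ r,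
        inner ℝ (f y - f x) (y - x) = 0 := by
  have hshift : ∀ᵐ t : Space n, ∀ᵐ x : Space n, x ∈ Ω → x + t ∈ Ω → ‖t‖ ∈ s →
      inner ℝ (f (x + t) - f x) t = 0 := by
    have h1 : ∀ᵐ x : Space n, ∀ᵐ t : Space n, x ∈ Ω → x + t ∈ Ω → ‖t‖ ∈ s →
        inner ℝ (f (x + t) - f x) t = 0 := by
      filter_upwards [h] with x hx
      filter_upwards [(measurePreserving_add_left (volume : Measure (Space n)) x
        ).quasiMeasurePreserving.ae hx] with t ht
      simpa using ht
    rwa [Measure.ae_ae_comm] at h1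
    have hm1 : Measurable fun p : Space n × Space n => inner ℝ (f (p.1 + p.2) - f p.1) p.2 := by
      have := hfm.measurable
      fun_prop
    have e : {p : Space n × Space n | p.1 ∈ Ω → p.1 + p.2 ∈ Ω → ‖p.2‖ ∈ s →
        inner ℝ (f (p.1 + p.2) - f p.1) p.2 = 0} =
        (Prod.fst ⁻¹' Ω)ᶜ ∪ (((fun p : Space n × Space n => p.1 + p.2) ⁻¹' Ω)ᶜ ∪
          (((fun p : Space n × Space n => ‖p.2‖) ⁻¹' s)ᶜ ∪
          ((fun p : Space n × Space n => inner ℝ (f (p.1 + p.2) - f p.1) p.2) ⁻¹' {0}))) := by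
      ext p
      simp only [mem_ofPred_eq, mem_union, mem_compl_iff, mem_preimage, mem_singleton_iff]
      tauto
    rw [e]
    refine (measurable_fst hΩ.measurableSet).compl.union
      (((measurable_fst.add measurable_snd) hΩ.measurableSet).compl.union
      ((measurable_snd.norm hs).compl.union (hm1 (measurableSet_singleton 0))))
  obtain ⟨ρ, hρ, hρΩ⟩ := Metric.isOpen_iff.1 hΩ x₀ hx₀
  set r := ρ / 3 with hr
  have hr0 : 0 < r := by positivity
  -- The ratio of the radii stays bounded, as almost everywhere convergence of the mollifications
  -- requires; supports in the ball of radius `r` keep all bonds involved inside `Ω`.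
  let φ : ℕ → ContDiffBump (0 : Space n) := fun i =>
    ⟨r / (2 * (i + 1)), r / (i + 1), by positivity, by
      rw [div_lt_div_iff_of_pos_left hr0 (by positivity) (by positivity)]
      linarith [(Nat.cast_nonneg i : (0 : ℝ) ≤ i)]⟩
  have hφ : ∀ i, (φ i).rOut ≤ r := fun i => div_le_self hr0.le (by simp)
  let F : ℕ → Space n → Space n := fun i =>
    convolution ((φ i).normed volume) f (ContinuousLinearMap.lsmul ℝ ℝ) volume
  have hFdiff : ∀ i, Differentiable ℝ (F i) := fun i =>
    ((φ i).hasCompactSupport_normed.contDiff_convolution_left (n := 1) _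
      (φ i).contDiff_normed hfi.locallyIntegrable).differentiable one_ne_zero
  have hFae : ∀ᵐ x : Space n, Tendsto (fun i => F i x) atTop (𝓝 (f x)) := by
    refine ContDiffBump.ae_convolution_tendsto_right_of_locallyIntegrable (K := 2) ?_ ?_
      hfi.locallyIntegrable
    · exact tendsto_const_div_atTop_nhds_zero_nat r |>.comp (tendsto_add_atTop_nat 1) |>.congr
        fun i => by simp [φ]
    · refine Eventually.of_forall fun i => le_of_eq ?_
      simp only [φ]
      field_simp
  have hFstretch : ∀ i, ∀ x ∈ Metric.ball x₀ r, ∀ᵐ t : Space n, ‖t‖ < r → ‖t‖ ∈ s →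
      inner ℝ (F i (x + t) - F i x) t = 0 := by
    intro i x hx
    filter_upwards [hshift] with t ht htr hts
    have hint : ∀ z, Integrable fun u => (φ i).normed volume u • f (z - u) := fun z =>
      (φ i).hasCompactSupport_normed.convolutionExists_left
        (ContinuousLinearMap.lsmul ℝ ℝ) (φ i).continuous_normed hfi.locallyIntegrable z
    have hF : ∀ z, F i z = ∫ u, (φ i).normed volume u • f (z - u) := fun z => rfl
    rw [hF, hF, ← integral_sub (hint _) (hint _), real_inner_comm,
      ← integral_inner (f := fun u => (φ i).normed volume u • f (x + t - u) -
        (φ i).normed volume u • f (x - u)) ((hint _).sub (hint _))]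
    refine integral_eq_zero_of_ae ?_
    filter_upwards [(Measure.measurePreserving_sub_left (volume : Measure (Space n)) x
      ).quasiMeasurePreserving.ae ht] with u hu
    rw [← smul_sub, inner_smul_right]
    by_cases hφu : (φ i).normed volume u = 0
    · simp [hφu]
    have hur : ‖u‖ < r := by
      have : u ∈ Function.support ((φ i).normed volume) := hφu
      rw [(φ i).support_normed_eq, mem_ball_zero_iff] at this
      exact this.trans_le (hφ i)
    rw [mem_ball_iff_norm] at hx
    have h1 : x - u ∈ Ω := hρΩ <| by
      rw [mem_ball_iff_norm, show x - u - x₀ = (x - x₀) - u by abel]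
      exact (norm_sub_le _ _).trans_lt (by linarith)
    have h2 : x - u + t ∈ Ω := hρΩ <| by
      rw [mem_ball_iff_norm, show x - u + t - x₀ = (x - x₀) - u + t by abel]
      exact (norm_add_le _ _).trans_lt (by linarith [norm_sub_le (x - x₀) u])
    rw [real_inner_comm, show x + t - u = x - u + t by abel, hu h1 h2 hts]
    simp
  refine ⟨r, hr0, {x | Tendsto (fun i => F i x) atTop (𝓝 (f x))}, hFae, ?_⟩
  rintro x ⟨hx, hxB⟩ y ⟨hy, hyB⟩
  have hlim : Tendsto (fun i => inner ℝ (F i y - F i x) (y - x)) atTop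
      (𝓝 (inner ℝ (f y - f x) (y - x))) :=
    (Tendsto.sub hy hx).inner tendsto_const_nhds
  refine tendsto_nhds_unique hlim (tendsto_const_nhds.congr fun i => ?_)
  exact (inner_sub_eq_zero_of_inner_fderiv (hFdiff i) (convex_ball x₀ r) (fun z hz v =>
    inner_fderiv_self_eq_zero hs hs0 hsv (hFdiff i z).hasFDerivAt hr0 (hFstretch i z hz) v)
    hxB hyB).symm

/-- A field that stretches no bond between points of `G` and vanishes on a nonnull part of `G`
vanishes on `G`: its value at `y` is orthogonal to all differences of zeros. -/
lemma eq_zero_of_inner_sub_eq_zero {f : Space n → Space n} {G Z : Set (Space n)}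
    (h : ∀ x ∈ G, ∀ y ∈ G, inner ℝ (f y - f x) (y - x) = 0) (hZG : Z ⊆ G)
    (hZ : ∀ x ∈ Z, f x = 0) (hvol : volume Z ≠ 0) {y : Space n} (hy : y ∈ G) : f y = 0 := by
  have hspan : affineSpan ℝ Z = ⊤ := by
    by_contra hne
    exact hvol (measure_mono_null (subset_affineSpan ℝ Z)
      (Measure.addHaar_affineSubspace _ _ hne))
  have hZne : Z.Nonempty := nonempty_of_measure_ne_zero hvol
  have hv : vectorSpan ℝ Z = ⊤ := by
    rw [← direction_affineSpan, hspan, AffineSubspace.direction_top]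
  have hle : vectorSpan ℝ Z ≤ (ℝ ∙ f y)ᗮ := by
    rw [vectorSpan, Submodule.span_le]
    rintro _ ⟨x, hx, x', hx', rfl⟩
    rw [SetLike.mem_coe, Submodule.mem_orthogonal_singleton_iff_inner_right]
    have h1 := h x (hZG hx) y hy
    have h2 := h x' (hZG hx') y hy
    rw [hZ _ hx, sub_zero, inner_sub_right] at h1
    rw [hZ _ hx', sub_zero, inner_sub_right] at h2
    simp only [vsub_eq_sub, inner_sub_right]
    linarith
  have : f y ∈ (ℝ ∙ f y)ᗮ := hle (hv ▸ Submodule.mem_top)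
  rw [Submodule.mem_orthogonal_singleton_iff_inner_right] at this
  exact inner_self_eq_zero.1 this

/-- On a connected open set, a field that does not stretch the bonds of lengths in `s` and vanishes
on a nonnull set vanishes almost everywhere. -/
theorem ae_eq_zero_of_inner_sub_eq_zero {s : Set ℝ} (hs : MeasurableSet s) (hs0 : s ⊆ Ioi 0)
    (hsv : ∀ δ : ℝ, 0 < δ → 0 < volume (s ∩ Iio δ)) {Ω : Set (Space n)} (hΩ : IsOpen Ω)
    (hconn : IsPreconnected Ω)
    {f : Space n → Space n} (hfm : StronglyMeasurable f) (hfi : Integrable f)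
    (h : ∀ᵐ x : Space n, ∀ᵐ y : Space n, x ∈ Ω → y ∈ Ω → ‖y - x‖ ∈ s →
      inner ℝ (f y - f x) (y - x) = 0)
    (hZ : volume {x ∈ Ω | f x = 0} ≠ 0) : ∀ᵐ x, x ∈ Ω → f x = 0 := by
  set u : Set (Space n) := {x | ∃ r > 0, ∀ᵐ y, y ∈ Metric.ball x r → f y = 0}
  set v : Set (Space n) := {x | ∃ r > 0, ∀ᵐ y, y ∈ Metric.ball x r → f y ≠ 0}
  have hopen : ∀ p : Space n → Prop,
      IsOpen {x : Space n | ∃ r > 0, ∀ᵐ y, y ∈ Metric.ball x r → p y} := by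
    intro p
    rw [Metric.isOpen_iff]
    rintro x ⟨r, hr, hx⟩
    refine ⟨r / 2, by positivity, fun z hz => ⟨r / 2, by positivity, ?_⟩⟩
    filter_upwards [hx] with y hy hyz
    refine hy (Metric.ball_subset_ball' ?_ hyz)
    rw [Metric.mem_ball] at hz
    linarith
  have hdisj : Disjoint u v := by
    rw [Set.disjoint_left]
    rintro x ⟨r, hr, hx⟩ ⟨r', hr', hx'⟩
    have hpos : volume (Metric.ball x (min r r')) ≠ 0 :=
      (Metric.measure_ball_pos volume x (lt_min hr hr')).ne'
    obtain ⟨y, hy, h1, h2⟩ :=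
      ((frequently_ae_mem_iff.2 hpos).and_eventually (hx.and hx')).exists
    exact h2 (Metric.ball_subset_ball (min_le_right _ _) hy)
      (h1 (Metric.ball_subset_ball (min_le_left _ _) hy))
  have hcover : Ω ⊆ u ∪ v := by
    intro x hx
    obtain ⟨r, hr, G, hG, hGs⟩ := exists_ball_inner_sub_eq_zero hs hs0 hsv hΩ hfm hfi h hx
    by_cases hvol : volume ({y | f y = 0} ∩ (G ∩ Metric.ball x r)) = 0
    · right
      refine ⟨r, hr, ?_⟩
      filter_upwards [hG, measure_eq_zero_iff_ae_notMem.1 hvol] with y hy hy' hyB hfy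
      exact hy' ⟨hfy, hy, hyB⟩
    · left
      refine ⟨r, hr, ?_⟩
      filter_upwards [hG] with y hy hyB
      exact eq_zero_of_inner_sub_eq_zero hGs inter_subset_right (fun z hz => hz.1) hvol ⟨hy, hyB⟩
  have hlocal : ∀ p : Space n → Prop,
      (∀ x ∈ Ω, ∃ r > 0, ∀ᵐ y, y ∈ Metric.ball x r → p y) → ∀ᵐ x, x ∈ Ω → p x := by
    intro p hp
    have : volume {x ∈ Ω | ¬ p x} = 0 := by
      refine measure_null_of_locally_null _ fun x hx => ?_
      obtain ⟨r, hr, hx'⟩ := hp x hx.1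
      refine ⟨{x ∈ Ω | ¬ p x} ∩ Metric.ball x r,
        inter_mem_nhdsWithin _ (Metric.ball_mem_nhds x hr), ?_⟩
      rw [measure_eq_zero_iff_ae_notMem]
      filter_upwards [hx'] with y hy hy'
      exact hy'.1.2 (hy hy'.2)
    filter_upwards [measure_eq_zero_iff_ae_notMem.1 this] with x hx hxΩ
    by_contra hpx
    exact hx ⟨hxΩ, hpx⟩
  rcases hconn.subset_or_subset (hopen _) (hopen _) hdisj hcover with hu | hv
  · exact hlocal _ hu
  · exfalso
    apply hZ
    rw [measure_eq_zero_iff_ae_notMem]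
    filter_upwards [hlocal _ hv] with x hx hx'
    exact hx hx'.1 hx'.2

/-! ### The linearized bond stiffness -/

lemma norm_unitVec_le (h : Space n) : ‖unitVec h‖ ≤ 1 := by
  rw [unitVec, norm_smul, norm_inv, norm_norm]
  exact inv_mul_le_one

lemma measurable_unitVec : Measurable (unitVec : Space n → Space n) := by
  unfold unitVec
  fun_prop

lemma unitVec_neg (h : Space n) : unitVec (-h) = -unitVec h := by
  simp [unitVec]

lemma unitBallVolume_pos : 0 < unitBallVolume n :=
  ENNReal.toReal_pos (Metric.measure_ball_pos volume 0 zero_lt_one).ne' measure_ball_lt_top.ne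

lemma strain_eq (u : Space n → Space n) (y x : Space n) :
    strain u y x = ‖y - x‖⁻¹ * inner ℝ (unitVec (y - x)) (u y - u x) := by
  rw [strain, real_inner_smul_left, real_inner_comm]

@[simp]
lemma strain_zero (y x : Space n) : strain 0 y x = 0 := by
  simp [strain_eq]

@[simp]
lemma scaledStrain_zero (y x : Space n) : scaledStrain 0 y x = 0 := by
  simp [scaledStrain]

namespace Model

variable (M : Model n)

/-- The weight `J(|h|/ε) / (ε^(n+1) ω_n)` as a function of the bond vector `h`, cut off at the
horizon. It allows integrals over `H_ε(x) ∩ Ω` to be written as integrals over `Ω`. -/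
def cutoffWeight (h : Space n) : ℝ :=
  (Metric.ball (0 : Space n) M.ε).indicator
    (fun h => M.J (‖h‖ / M.ε) / (M.ε ^ (n + 1) * unitBallVolume n)) h

/-- The stiffness `g''(0) (J(|h|/ε) / (ε^(n+1) ω_n |h|)) e_h ⊗ e_h` of an unstrained bond `h`. -/
def stiffness (h : Space n) : Space n →L[ℝ] Space n :=
  (M.cutoffWeight h * ‖h‖⁻¹ * iteratedDeriv 2 M.g 0) •
    InnerProductSpace.rankOne ℝ (unitVec h) (unitVec h)

/-- The lengths of the bonds that carry a positive weight. -/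
def bondLengths : Set ℝ := {r | 0 < r ∧ r < M.ε ∧ 0 < M.J (r / M.ε)}

variable {M}

namespace Admissible

variable (hM : M.Admissible)
include hM

lemma weight_denom_pos : 0 < M.ε ^ (n + 1) * unitBallVolume n :=
  mul_pos (pow_pos hM.ε_pos _) unitBallVolume_pos

lemma cutoffWeight_nonneg (h : Space n) : 0 ≤ M.cutoffWeight h :=
  indicator_nonneg (fun _ _ => div_nonneg (hM.influence.nonneg _) hM.weight_denom_pos.le) _

lemma exists_cutoffWeight_le : ∃ W : ℝ, ∀ h : Space n, M.cutoffWeight h ≤ W := by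
  obtain ⟨C, hC⟩ := hM.influence.bounded
  have hC0 : 0 ≤ C := (hM.influence.nonneg 0).trans (hC 0)
  refine ⟨C / (M.ε ^ (n + 1) * unitBallVolume n), fun h => ?_⟩
  refine indicator_le' (fun h _ => ?_) (fun _ _ => div_nonneg hC0 hM.weight_denom_pos.le) h
  exact div_le_div_of_nonneg_right (hC _) hM.weight_denom_pos.le

lemma measurable_cutoffWeight : Measurable M.cutoffWeight := by
  refine Measurable.indicator ?_ measurableSet_ball
  have := hM.influence.measurable
  fun_prop

omit hM in
lemma cutoffWeight_neg (h : Space n) : M.cutoffWeight (-h) = M.cutoffWeight h := by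
  simp only [cutoffWeight, indicator, mem_ball_zero_iff, norm_neg]

omit hM in
lemma cutoffWeight_sub {x y : Space n} (hy : y ∈ Metric.ball x M.ε) :
    M.cutoffWeight (y - x) = M.weight y x := by
  rw [cutoffWeight, indicator_of_mem (by rwa [mem_ball_zero_iff, ← mem_ball_iff_norm]), weight]

omit hM in
lemma cutoffWeight_sub_of_notMem {x y : Space n} (hy : y ∉ Metric.ball x M.ε) :
    M.cutoffWeight (y - x) = 0 :=
  indicator_of_notMem (by rwa [mem_ball_zero_iff, ← mem_ball_iff_norm]) _

omit hM in
lemma setIntegral_ball_inter {E : Type*} [NormedAddCommGroup E] [NormedSpace ℝ E]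
    {x : Space n} {F F' : Space n → E} (h : ∀ y ∈ Metric.ball x M.ε, F y = F' y)
    (h' : ∀ y ∉ Metric.ball x M.ε, F' y = 0) :
    ∫ y in Metric.ball x M.ε ∩ M.Ω, F y = ∫ y, F' y ∂M.μ := by
  rw [← Measure.restrict_restrict measurableSet_ball, ← integral_indicator measurableSet_ball]
  congr 1
  ext1 y
  by_cases hy : y ∈ Metric.ball x M.ε
  · rw [indicator_of_mem hy, h y hy]
  · rw [indicator_of_notMem hy, h' y hy]

/-- The weight against the weak singularities `|h|^p`, `p > -2`, is integrable. -/
lemma integrable_cutoffWeight_mul_rpow (hn : 2 ≤ n) {p : ℝ} (hp : -2 < p) :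
    Integrable fun h : Space n => M.cutoffWeight h * ‖h‖ ^ p := by
  obtain ⟨W, hW⟩ := hM.exists_cutoffWeight_le
  have h1 := ((integrableOn_ball_rpow_norm hn hp M.ε).integrable_indicator
    measurableSet_ball).const_mul W
  refine h1.mono' ?_ (Eventually.of_forall fun h => ?_)
  · have := hM.measurable_cutoffWeight
    exact Measurable.aestronglyMeasurable (by fun_prop)
  · have h0 : 0 ≤ ‖h‖ ^ p := Real.rpow_nonneg (norm_nonneg _) _
    rw [Real.norm_of_nonneg (mul_nonneg (hM.cutoffWeight_nonneg h) h0)]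
    by_cases hh : h ∈ Metric.ball (0 : Space n) M.ε
    · rw [indicator_of_mem hh]
      exact mul_le_mul_of_nonneg_right (hW h) h0
    · rw [indicator_of_notMem hh, cutoffWeight, indicator_of_notMem hh]
      simp

lemma integrable_cutoffWeight_mul_inv (hn : 2 ≤ n) :
    Integrable fun h : Space n => M.cutoffWeight h * ‖h‖⁻¹ := by
  simpa [Real.rpow_neg_one] using
    hM.integrable_cutoffWeight_mul_rpow hn (p := -1) (by norm_num)

omit hM in
lemma stiffness_apply (h v : Space n) : M.stiffness h v =
    (M.cutoffWeight h * ‖h‖⁻¹ * iteratedDeriv 2 M.g 0 * inner ℝ (unitVec h) v) • unitVec h := by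
  simp [stiffness, smul_smul]

omit hM in
lemma inner_stiffness_apply (h v : Space n) : inner ℝ (M.stiffness h v) v =
    M.cutoffWeight h * ‖h‖⁻¹ * iteratedDeriv 2 M.g 0 * inner ℝ (unitVec h) v ^ 2 := by
  rw [stiffness_apply, real_inner_smul_left]
  ring

omit hM in
lemma stiffness_neg (h : Space n) : M.stiffness (-h) = M.stiffness h := by
  ext1 v
  simp [stiffness_apply, cutoffWeight_neg, unitVec_neg]

lemma stiffness_coeff_nonneg (h : Space n) :
    0 ≤ M.cutoffWeight h * ‖h‖⁻¹ * iteratedDeriv 2 M.g 0 :=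
  mul_nonneg (mul_nonneg (hM.cutoffWeight_nonneg h) (inv_nonneg.2 (norm_nonneg h)))
    hM.potential.second_pos.le

lemma inner_stiffness_nonneg (h v : Space n) : 0 ≤ inner ℝ (M.stiffness h v) v := by
  rw [inner_stiffness_apply]
  exact mul_nonneg (hM.stiffness_coeff_nonneg h) (sq_nonneg _)

lemma stronglyMeasurable_stiffness : StronglyMeasurable M.stiffness := by
  have hc : Continuous fun e : Space n => InnerProductSpace.rankOne ℝ e e :=
    (InnerProductSpace.rankOne ℝ).continuous.clm_apply continuous_id
  have h1 : StronglyMeasurable fun h : Space n =>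
      InnerProductSpace.rankOne ℝ (unitVec h) (unitVec h) :=
    hc.comp_stronglyMeasurable measurable_unitVec.stronglyMeasurable
  have h2 : Measurable fun h : Space n =>
      M.cutoffWeight h * ‖h‖⁻¹ * iteratedDeriv 2 M.g 0 := by
    have := hM.measurable_cutoffWeight
    fun_prop
  exact h2.stronglyMeasurable.smul h1

lemma norm_stiffness_le (h : Space n) :
    ‖M.stiffness h‖ ≤ M.cutoffWeight h * ‖h‖⁻¹ * iteratedDeriv 2 M.g 0 := by
  rw [stiffness, norm_smul, Real.norm_of_nonneg (hM.stiffness_coeff_nonneg h),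
    InnerProductSpace.norm_rankOne]
  exact mul_le_of_le_one_right (hM.stiffness_coeff_nonneg h)
    (mul_le_one₀ (norm_unitVec_le h) (norm_nonneg _) (norm_unitVec_le h))

lemma integrable_stiffness (hn : 2 ≤ n) : Integrable M.stiffness :=
  ((hM.integrable_cutoffWeight_mul_inv hn).mul_const _).mono'
    hM.stronglyMeasurable_stiffness.aestronglyMeasurable
    (Eventually.of_forall hM.norm_stiffness_le)

omit hM in
/-- The linearized operator at `0` in terms of the stiffness. -/
lemma L'_zero_apply (w : Space n → Space n) {x : Space n} (hx : x ∈ M.D) :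
    M.L' 0 w x = -∫ y, (2 : ℝ) • M.stiffness (y - x) (w y - w x) ∂M.μ := by
  rw [L', indicator_of_mem hx]
  congr 1
  refine setIntegral_ball_inter (fun y hy => ?_) (fun y hy => ?_)
  · rw [stiffness_apply, cutoffWeight_sub hy, strain_eq, scaledStrain_zero, smul_smul]
    congr 1
    ring
  · simp [stiffness_apply, cutoffWeight_sub_of_notMem hy]

omit hM in
/-- The force density of the intact body as an integral over `Ω`. -/
lemma L_initialBonds_apply (u : Space n → Space n) {x : Space n} (hx : x ∈ M.D) :
    M.L initialBonds u x = -∫ y, (2 * (M.cutoffWeight (y - x) / Real.sqrt ‖y - x‖) *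
      deriv M.g (scaledStrain u y x)) • unitVec (y - x) ∂M.μ := by
  rw [L, indicator_of_mem hx, forceDensity]
  congr 1
  refine setIntegral_ball_inter (fun y hy => ?_) (fun y hy => ?_)
  · rw [cutoffWeight_sub hy, initialBonds, mul_one]
  · simp [cutoffWeight_sub_of_notMem hy]

lemma measurableSet_bondLengths : MeasurableSet M.bondLengths := by
  have h1 : Measurable fun r : ℝ => M.J (r / M.ε) := by
    have := hM.influence.measurable
    fun_prop
  exact (measurableSet_Ioi (a := (0 : ℝ))).inter
    ((measurableSet_Iio (a := M.ε)).inter (h1 measurableSet_Ioi))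

omit hM in
lemma bondLengths_subset : M.bondLengths ⊆ Ioi 0 := fun _ hr => hr.1

/-- Arbitrarily short bonds carry weight. -/
lemma volume_bondLengths_pos {δ : ℝ} (hδ : 0 < δ) : 0 < volume (M.bondLengths ∩ Iio δ) := by
  have hε := hM.ε_pos
  have h1 := hM.influence.zero_mem_support (min δ M.ε / M.ε)
    (div_pos (lt_min hδ hε) hε)
  refine lt_of_lt_of_le ?_ (measure_mono (s := (fun r => r * M.ε⁻¹) ⁻¹'
    {r | r ∈ Ioo 0 (min δ M.ε / M.ε) ∧ 0 < M.J r}) ?_)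
  · rw [Real.volume_preimage_mul_right (inv_ne_zero hε.ne')]
    refine ENNReal.mul_pos ?_ h1.ne'
    simp [hε.ne']
  · rintro r ⟨⟨h2, h3⟩, h4⟩
    beta_reduce at h2 h3 h4
    rw [← div_eq_mul_inv] at h2 h3 h4
    rw [div_lt_div_iff_of_pos_right hε, lt_min_iff] at h3
    exact ⟨⟨(div_pos_iff_of_pos_right hε).1 h2, h3.2, h4⟩, h3.1⟩

lemma stiffness_coeff_pos {h : Space n} (hh : ‖h‖ ∈ M.bondLengths) :
    0 < M.cutoffWeight h * ‖h‖⁻¹ * iteratedDeriv 2 M.g 0 := by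
  have h1 : 0 < M.cutoffWeight h := by
    rw [cutoffWeight, indicator_of_mem (by simpa using hh.2.1)]
    exact div_pos hh.2.2 hM.weight_denom_pos
  exact mul_pos (mul_pos h1 (inv_pos.2 hh.1)) hM.potential.second_pos

/-! ### Coercivity of the stability tensor -/

/-- The total stiffness of the bonds in a cone is positive definite, because the bonds orthogonal to
a given direction form a null set. -/
lemma exists_cone_coercive (hn : 2 ≤ n) {C : Set (Space n)} (hC : MeasurableSet C) {κ ρ : ℝ}
    (hκ : κ < 1) (hρ : 0 < ρ) {ξ : Space n} (hξ : ‖ξ‖ = 1)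
    (hCξ : ∀ h : Space n, 0 < ‖h‖ → ‖h‖ < ρ → κ * ‖h‖ < inner ℝ h ξ → h ∈ C) :
    ∃ c : ℝ, 0 < c ∧ ∀ v : Space n, c * ‖v‖ ^ 2 ≤ ∫ h in C, inner ℝ (M.stiffness h v) v := by
  have hint : ∀ v : Space n, IntegrableOn (fun h => M.stiffness h v) C := fun v =>
    ((hM.integrable_stiffness hn).apply_continuousLinearMap v).integrableOn
  have hint2 : ∀ v : Space n, IntegrableOn (fun h => inner ℝ (M.stiffness h v) v) C := fun v =>
    (hint v).inner_const v
  set Q : Space n → ℝ := fun v => ∫ h in C, inner ℝ (M.stiffness h v) v with hQ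
  have hQeq : ∀ v, Q v = inner ℝ ((∫ h in C, M.stiffness h) v) v := by
    intro v
    rw [ContinuousLinearMap.integral_apply (hM.integrable_stiffness hn).integrableOn,
      real_inner_comm, ← integral_inner (hint v)]
    simp only [hQ, real_inner_comm]
  have hQcont : Continuous Q := by
    rw [funext hQeq]
    fun_prop
  have hQpos : ∀ v, v ≠ 0 → 0 < Q v := by
    intro v hv
    rw [hQ, integral_pos_iff_support_of_nonneg (fun h => hM.inner_stiffness_nonneg h v) (hint2 v),
      Measure.restrict_apply' hC]
    have hpos := volume_cone_pos (hM.measurableSet_bondLengths.inter measurableSet_Iio)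
      (inter_subset_left.trans bondLengths_subset) (hM.volume_bondLengths_pos hρ) hκ hξ
    have hnull : volume ((ℝ ∙ v)ᗮ : Set (Space n)) = 0 := by
      refine Measure.addHaar_submodule _ _ fun htop => hv ?_
      have : v ∈ (ℝ ∙ v)ᗮ := htop ▸ Submodule.mem_top
      rw [Submodule.mem_orthogonal_singleton_iff_inner_right] at this
      exact inner_self_eq_zero.1 this
    rw [← measure_sdiff_null hnull] at hpos
    refine hpos.trans_le (measure_mono ?_)
    rintro h ⟨⟨⟨h1, h2⟩, h3⟩, h4⟩
    refine ⟨?_, hCξ h h1.1 h2 h3⟩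
    rw [SetLike.mem_coe, Submodule.mem_orthogonal_singleton_iff_inner_left] at h4
    have h5 : inner ℝ (unitVec h) v ≠ 0 := by
      rw [unitVec, real_inner_smul_left]
      exact mul_ne_zero (inv_ne_zero h1.1.ne') h4
    rw [Function.mem_support, inner_stiffness_apply]
    exact (mul_pos (hM.stiffness_coeff_pos h1) (by positivity)).ne'
  obtain ⟨e, he, hmin⟩ := (isCompact_sphere (0 : Space n) 1).exists_isMinOn
    ⟨ξ, by simpa using hξ⟩ hQcont.continuousOn
  have he1 : ‖e‖ = 1 := by simpa using he
  refine ⟨Q e, hQpos e (by rintro rfl; simp at he1), fun v => ?_⟩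
  rcases eq_or_ne v 0 with rfl | hv
  · simp
  have hvn : ‖v‖ ≠ 0 := norm_ne_zero_iff.2 hv
  have h1 : Q e ≤ Q (‖v‖⁻¹ • v) := hmin (by simp [norm_smul, hvn])
  have h2 : Q (‖v‖⁻¹ • v) * ‖v‖ ^ 2 = Q v := by
    rw [hQeq, hQeq, map_smul, real_inner_smul_left, real_inner_smul_right]
    field_simp
  calc Q e * ‖v‖ ^ 2 ≤ Q (‖v‖⁻¹ • v) * ‖v‖ ^ 2 := by gcongr
    _ = Q v := h2

omit hM in
lemma inner_stiffness_map (R : Space n ≃ₗᵢ[ℝ] Space n) (h v : Space n) :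
    inner ℝ (M.stiffness (R h) (R v)) (R v) = inner ℝ (M.stiffness h v) v := by
  have h1 : M.cutoffWeight (R h) = M.cutoffWeight h := by
    simp only [cutoffWeight, indicator, mem_ball_zero_iff, LinearIsometryEquiv.norm_map]
  have h2 : unitVec (R h) = R (unitVec h) := by simp [unitVec]
  rw [inner_stiffness_apply, inner_stiffness_apply, h1, h2, LinearIsometryEquiv.norm_map,
    LinearIsometryEquiv.inner_map_map]

/-- The interior cone condition makes the stability tensor coercive uniformly on `D`: congruent
cones have, up to a linear isometry, the same total stiffness. -/
lemma exists_coercive (hn : 2 ≤ n) : ∃ c : ℝ, 0 < c ∧ ∀ x ∈ M.D, ∀ v : Space n,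
    c * ‖v‖ ^ 2 ≤ inner ℝ ((∫ y, M.stiffness (y - x) ∂M.μ) v) v := by
  obtain ⟨κ, ρ, hκ, hρ, hcone⟩ := hM.cone
  let C : Space n → Set (Space n) := fun ξ =>
    {h | 0 < ‖h‖ ∧ ‖h‖ < ρ ∧ κ * ‖h‖ < inner ℝ h ξ}
  have hC : ∀ ξ, MeasurableSet (C ξ) := fun ξ =>
    (measurableSet_lt measurable_const measurable_norm).inter
      ((measurableSet_lt measurable_norm measurable_const).inter
      (measurableSet_lt (f := fun h : Space n => κ * ‖h‖) (by fun_prop) (by fun_prop)))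
  let ξ₀ : Space n := EuclideanSpace.single ⟨0, by omega⟩ 1
  have hξ₀ : ‖ξ₀‖ = 1 := by simp [ξ₀]
  obtain ⟨c, hc, hcv⟩ := hM.exists_cone_coercive hn (hC ξ₀) hκ hρ hξ₀
    (fun h h1 h2 h3 => ⟨h1, h2, h3⟩)
  refine ⟨c, hc, fun x hx v => ?_⟩
  obtain ⟨ξ, hξ, hΩ⟩ := hcone x hx
  -- the reflection exchanging the axes of the two cones
  set R : Space n ≃ₗᵢ[ℝ] Space n := (ℝ ∙ (ξ - ξ₀))ᗮ.reflection
  have hR : R ξ = ξ₀ := Submodule.reflection_sub (hξ.trans hξ₀.symm)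
  have hint : ∀ v : Space n, Integrable (fun h => inner ℝ (M.stiffness h v) v) := fun v =>
    ((hM.integrable_stiffness hn).apply_continuousLinearMap v).inner_const v
  have hintx : Integrable (fun y => M.stiffness (y - x)) M.μ :=
    ((hM.integrable_stiffness hn).comp_sub_right x).integrableOn
  have hA : inner ℝ ((∫ y, M.stiffness (y - x) ∂M.μ) v) v =
      ∫ y in M.Ω, inner ℝ (M.stiffness (y - x) v) v := by
    rw [ContinuousLinearMap.integral_apply hintx, real_inner_comm,
      ← integral_inner (hintx.apply_continuousLinearMap v)]
    simp only [real_inner_comm]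
  have hrot : ∫ h in C ξ₀, inner ℝ (M.stiffness h (R v)) (R v) =
      ∫ h in C ξ, inner ℝ (M.stiffness h v) v := by
    rw [← R.measurePreserving.setIntegral_preimage_emb R.toMeasurableEquiv.measurableEmbedding]
    have hpre : R ⁻¹' (C ξ₀) = C ξ := by
      ext h
      simp only [C, mem_preimage, mem_ofPred_eq, LinearIsometryEquiv.norm_map]
      rw [← hR, LinearIsometryEquiv.inner_map_map]
    rw [hpre]
    simp only [inner_stiffness_map]
  have hshift : ∫ h in C ξ, inner ℝ (M.stiffness h v) v =
      ∫ y in (fun y => y - x) ⁻¹' (C ξ), inner ℝ (M.stiffness (y - x) v) v :=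
    ((measurePreserving_sub_right volume x).setIntegral_preimage_emb
      (measurableEmbedding_subRight x) (fun h => inner ℝ (M.stiffness h v) v) (C ξ)).symm
  have h1 := hcv (R v)
  rw [hrot, hshift, LinearIsometryEquiv.norm_map] at h1
  rw [hA]
  refine h1.trans (setIntegral_mono_set ((hint v).comp_sub_right x).integrableOn
    (Eventually.of_forall fun y => hM.inner_stiffness_nonneg _ v)
    (LE.le.eventuallyLE ?_))
  rintro y ⟨h2, h3, h4⟩
  exact hΩ y h2 h3 h4

/-! ### The energy identity -/

lemma isFiniteMeasure : IsFiniteMeasure M.μ :=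
  isFiniteMeasure_restrict.2 hM.isBounded.measure_lt_top.ne

lemma integrable_stiffness_coeff_mul (hn : 2 ≤ n) {a : Space n → ℝ} (ha : Integrable a M.μ) :
    Integrable (fun p : Space n × Space n =>
      M.cutoffWeight (p.2 - p.1) * ‖p.2 - p.1‖⁻¹ * iteratedDeriv 2 M.g 0 * (a p.1 + a p.2))
      (M.μ.prod M.μ) := by
  have h1 : Integrable (fun p : Space n × Space n =>
      M.cutoffWeight (p.2 - p.1) * ‖p.2 - p.1‖⁻¹ * iteratedDeriv 2 M.g 0 * a p.2)
      (M.μ.prod M.μ) := by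
    have h := ha.convolution_integrand (ContinuousLinearMap.mul ℝ ℝ) (μ := volume)
      ((hM.integrable_cutoffWeight_mul_inv hn).mul_const (iteratedDeriv 2 M.g 0))
    have h' := h.mono_measure (Measure.prod_mono (Measure.restrict_le_self (s := M.Ω)) le_rfl)
    refine h'.congr (Eventually.of_forall fun p => ?_)
    simp only [ContinuousLinearMap.mul_apply']
    rw [← neg_sub p.2 p.1, cutoffWeight_neg, norm_neg]
    ring
  refine (h1.swap.add h1).congr (Eventually.of_forall fun p => ?_)
  simp only [Pi.add_apply, Function.comp_apply, Prod.fst_swap, Prod.snd_swap]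
  rw [← neg_sub p.2 p.1, cutoffWeight_neg, norm_neg]
  ring

/-- Testing `𝓛'[0] f = 0` with `f` shows that `f` does not stretch the bonds carrying weight. -/
lemma inner_sub_eq_zero_of_L'_zero (hn : 2 ≤ n) {f : Space n → Space n}
    (hfm : StronglyMeasurable f) (hf2 : MemLp f 2 M.μ)
    (hf0 : ∀ᵐ x ∂M.μ, x ∈ M.Ωd → f x = 0) (hL : M.L' 0 f =ᵐ[M.μ] 0) :
    ∀ᵐ x ∂M.μ, ∀ᵐ y ∂M.μ, ‖y - x‖ ∈ M.bondLengths → inner ℝ (f y - f x) (y - x) = 0 := by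
  have := hM.isFiniteMeasure
  set κ : Space n → ℝ := fun h => M.cutoffWeight h * ‖h‖⁻¹ * iteratedDeriv 2 M.g 0 with hκ
  have hκ0 : ∀ h, 0 ≤ κ h := hM.stiffness_coeff_nonneg
  have hf1 : Integrable f M.μ := hf2.integrable one_le_two
  let G : Space n × Space n → Space n := fun p => M.stiffness (p.2 - p.1) (f p.2 - f p.1)
  let F : Space n × Space n → ℝ := fun p => inner ℝ (G p) (f p.1)
  have hnormG : ∀ p, ‖G p‖ ≤ κ (p.2 - p.1) * ‖f p.2 - f p.1‖ := fun p =>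
    (M.stiffness (p.2 - p.1)).le_of_opNorm_le (hM.norm_stiffness_le _) _
  have hd : StronglyMeasurable fun p : Space n × Space n => f p.2 - f p.1 :=
    (hfm.comp_measurable measurable_snd).sub (hfm.comp_measurable measurable_fst)
  have hGm : StronglyMeasurable G := by
    have h1 : StronglyMeasurable fun p : Space n × Space n => M.stiffness (p.2 - p.1) :=
      hM.stronglyMeasurable_stiffness.comp_measurable (measurable_snd.sub measurable_fst)
    exact isBoundedBilinearMap_apply.continuous.comp_stronglyMeasurable (h1.prodMk hd)
  have hGi : Integrable G (M.μ.prod M.μ) := by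
    refine (hM.integrable_stiffness_coeff_mul hn hf1.norm).mono' hGm.aestronglyMeasurable
      (Eventually.of_forall fun p => (hnormG p).trans ?_)
    exact mul_le_mul_of_nonneg_left ((norm_sub_le _ _).trans (add_comm _ _).le) (hκ0 _)
  have hFi : Integrable F (M.μ.prod M.μ) := by
    refine ((hM.integrable_stiffness_coeff_mul hn hf2.integrable_norm_pow').const_mul 2).mono'
      (hGm.inner (hfm.comp_measurable measurable_fst)).aestronglyMeasurable
      (Eventually.of_forall fun p => ?_)
    have h1 : ‖F p‖ ≤ κ (p.2 - p.1) * (‖f p.2 - f p.1‖ * ‖f p.1‖) := by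
      rw [← mul_assoc]
      exact (norm_inner_le_norm _ _).trans (mul_le_mul_of_nonneg_right (hnormG p) (norm_nonneg _))
    refine h1.trans ?_
    rw [mul_left_comm 2]
    refine mul_le_mul_of_nonneg_left ?_ (hκ0 _)
    have h2 := norm_sub_le (f p.2) (f p.1)
    nlinarith [norm_nonneg (f p.1), norm_nonneg (f p.2), sq_nonneg (‖f p.1‖ - ‖f p.2‖),
      mul_le_mul_of_nonneg_right h2 (norm_nonneg (f p.1))]
  have hF0 : ∫ p, F p ∂(M.μ.prod M.μ) = 0 := by
    rw [integral_prod _ hFi]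
    refine integral_eq_zero_of_ae ?_
    filter_upwards [hL, hf0, hGi.prod_right_ae,
      ae_restrict_mem hM.isOpen.measurableSet] with x hx hx0 hGx hxΩ
    have h1 : ∫ y, F (x, y) ∂M.μ = inner ℝ (f x) (∫ y, G (x, y) ∂M.μ) := by
      rw [← integral_inner hGx]
      simp only [F, real_inner_comm]
    rw [h1]
    by_cases hxd : x ∈ M.Ωd
    · simp [hx0 hxd]
    · rw [L'_zero_apply f (show x ∈ M.D from ⟨hxΩ, hxd⟩), integral_smul] at hx
      have : ∫ y, G (x, y) ∂M.μ = 0 := by simpa [G] using hx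
      simp [this]
  let E : Space n × Space n → ℝ := fun p => inner ℝ (G p) (f p.2 - f p.1)
  -- exchanging the ends of the bonds changes the sign of `G`
  have hsum : ∀ p, E p = -(F p + F p.swap) := by
    intro p
    have h1 : G p.swap = - G p := by
      simp only [G, Prod.fst_swap, Prod.snd_swap]
      rw [← neg_sub p.2 p.1, stiffness_neg, ← neg_sub (f p.2) (f p.1), map_neg]
    simp only [E, F, h1, Prod.fst_swap, inner_sub_right, inner_neg_left]
    ring
  have hEi : Integrable E (M.μ.prod M.μ) :=
    (hFi.add hFi.swap).neg.congr (Eventually.of_forall fun p => (hsum p).symm)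
  have hswap : ∫ p, (F ∘ Prod.swap) p ∂(M.μ.prod M.μ) = 0 :=
    (integral_prod_swap F).trans hF0
  have hE0 : ∫ p, E p ∂(M.μ.prod M.μ) = 0 := by
    have h1 : ∫ p, (F + F ∘ Prod.swap) p ∂(M.μ.prod M.μ) = 0 := by
      rw [integral_add' hFi hFi.swap, hF0, hswap, add_zero]
    calc ∫ p, E p ∂(M.μ.prod M.μ) = ∫ p, -(F + F ∘ Prod.swap) p ∂(M.μ.prod M.μ) :=
          integral_congr_ae (Eventually.of_forall hsum)
      _ = 0 := by rw [integral_neg, h1, neg_zero]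
  have hEpos : 0 ≤ E := fun p => hM.inner_stiffness_nonneg _ _
  have hEae := Measure.ae_ae_of_ae_prod ((integral_eq_zero_iff_of_nonneg hEpos hEi).1 hE0)
  filter_upwards [hEae] with x hx
  filter_upwards [hx] with y hy hyx
  have h1 : κ (y - x) * inner ℝ (unitVec (y - x)) (f y - f x) ^ 2 = 0 := by
    rw [← inner_stiffness_apply]; exact hy
  have h2 := (mul_eq_zero.1 h1).resolve_left (hM.stiffness_coeff_pos hyx).ne'
  have h3 := pow_eq_zero_iff two_ne_zero |>.1 h2
  rw [unitVec, real_inner_smul_left] at h3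
  rw [real_inner_comm]
  exact (mul_eq_zero.1 h3).resolve_left (inv_ne_zero hyx.1.ne')

/-- The linearized operator is injective on square integrable fields vanishing on `Ωd`. -/
theorem ae_eq_zero_of_L'_zero (hn : 2 ≤ n) {f : Space n → Space n}
    (hfm : StronglyMeasurable f) (hf2 : MemLp f 2 M.μ)
    (hf0 : ∀ᵐ x ∂M.μ, x ∈ M.Ωd → f x = 0) (hL : M.L' 0 f =ᵐ[M.μ] 0) : f =ᵐ[M.μ] 0 := by
  have := hM.isFiniteMeasure
  have hΩm := hM.isOpen.measurableSet
  have h := hM.inner_sub_eq_zero_of_L'_zero hn hfm hf2 hf0 hL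
  have hfi : Integrable (M.Ω.indicator f) :=
    (integrable_indicator_iff hΩm).2 (hf2.integrable one_le_two)
  have key := ae_eq_zero_of_inner_sub_eq_zero hM.measurableSet_bondLengths bondLengths_subset
    (fun δ hδ => hM.volume_bondLengths_pos hδ) hM.isOpen hM.isConnected.isPreconnected
    (hfm.indicator hΩm) hfi ?_ ?_
  · refine (ae_restrict_iff' hΩm).2 ?_
    filter_upwards [key] with x hx hxΩ
    simpa [indicator_of_mem hxΩ] using hx hxΩ
  · filter_upwards [(ae_restrict_iff' hΩm).1 h] with x hx
    by_cases hxΩ : x ∈ M.Ω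
    · filter_upwards [(ae_restrict_iff' hΩm).1 (hx hxΩ)] with y hy _ hyΩ
      rw [indicator_of_mem hxΩ, indicator_of_mem hyΩ]
      exact hy hyΩ
    · exact Eventually.of_forall fun y hx' => absurd hx' hxΩ
  · refine (hM.volume_pos.trans_le (measure_mono_ae ?_)).ne'
    filter_upwards [(ae_restrict_iff' hΩm).1 hf0] with x hx hxd
    exact ⟨hM.subset hxd, by rw [indicator_of_mem (hM.subset hxd)]; exact hx (hM.subset hxd) hxd⟩

end Admissible

end Model

/-! ### Bounded displacements and integral operators -/

/-- Fredholm alternative for a compact perturbation of an operator `N`, some multiple of which is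
close to the identity. -/
lemma isUnit_smul_sub_of_isCompactOperator {X : Type*} [NormedAddCommGroup X] [NormedSpace ℝ X]
    [CompleteSpace X] {N K : X →L[ℝ] X} (hK : IsCompactOperator K) {τ : ℝ} (hτ : τ ≠ 0)
    (hN : ‖1 - τ • N‖ < 1) (hinj : ∀ v, N v = K v → v = 0) {σ : ℝ} (hσ : σ ≠ 0) :
    IsUnit (σ • (N - K)) := by
  set U : (X →L[ℝ] X)ˣ := Units.oneSub (1 - τ • N) hN
  have hU : (U : X →L[ℝ] X) = τ • N := by simp [U]
  set T : X →L[ℝ] X := (↑U⁻¹ : X →L[ℝ] X) * (τ • K)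
  have hUT : (U : X →L[ℝ] X) * T = τ • K := by simp [T]
  have hT : IsCompactOperator T := (hK.smul τ).clm_comp (↑U⁻¹ : X →L[ℝ] X)
  have hnot : ¬ Module.End.HasEigenvalue (T : Module.End ℝ X) 1 := by
    intro h
    obtain ⟨v, hv⟩ := h.exists_hasEigenvector
    have h1 : T v = v := by simpa using hv.apply_eq_smul
    have h2 : τ • N v = τ • K v := by
      have := congrArg (fun S : X →L[ℝ] X => S v) hUT
      simp only [mul_apply_eq_comp, h1, hU] at this
      exact this
    exact hv.2 (hinj v (smul_right_injective X hτ h2))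
  have hres := (hT.hasEigenvalue_or_mem_resolventSet one_ne_zero).resolve_left hnot
  rw [spectrum.mem_resolventSet_iff, map_one] at hres
  have h3 : IsUnit (τ • (N - K)) := by
    have : τ • (N - K) = U * (1 - T) := by rw [mul_sub, mul_one, hU, ← hU, hUT, hU, smul_sub]
    rw [this]
    exact U.isUnit.mul hres
  have h4 : σ • (N - K) = Units.mk0 (σ / τ) (div_ne_zero hσ hτ) • (τ • (N - K)) := by
    rw [Units.smul_def, smul_smul, Units.val_mk0, div_mul_cancel₀ _ hτ]
  rw [h4]
  exact h3.smul _

namespace Model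

variable {n : ℕ} {M : Model n}

lemma ae_norm_le_norm (u : M.Displacement ∞) : ∀ᵐ x ∂M.μ, ‖u x‖ ≤ ‖u‖ := by
  have h := ae_le_eLpNormEssSup (f := u) (μ := M.μ)
  filter_upwards [h] with x hx
  rw [Lp.norm_def, eLpNorm_exponent_top, ← toReal_enorm (u x)]
  refine ENNReal.toReal_mono ?_ hx
  rw [← eLpNorm_exponent_top]
  exact Lp.eLpNorm_ne_top u

/-- Integration of a function dominated by a translated integrable kernel. -/
lemma integrable_and_norm_integral_le {E : Type*} [NormedAddCommGroup E] [NormedSpace ℝ E]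
    {b : Space n → E} (hb : AEStronglyMeasurable b M.μ)
    {κ : Space n → ℝ} (hκ : Integrable κ) (hκ0 : ∀ h, 0 ≤ κ h) {C : ℝ} (hC : 0 ≤ C)
    {x : Space n} (h : ∀ᵐ y ∂M.μ, ‖b y‖ ≤ κ (y - x) * C) :
    Integrable b M.μ ∧ ‖∫ y, b y ∂M.μ‖ ≤ (∫ h, κ h) * C := by
  have hi : Integrable (fun y => κ (y - x) * C) := (hκ.comp_sub_right x).mul_const C
  refine ⟨hi.integrableOn.mono' hb h, (norm_integral_le_of_norm_le hi.integrableOn h).trans ?_⟩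
  refine (setIntegral_le_integral hi
    (Eventually.of_forall fun y => mul_nonneg (hκ0 _) hC)).trans_eq ?_
  rw [integral_mul_const, integral_sub_right_eq_self κ x]

namespace Admissible

variable (hM : M.Admissible)
include hM

lemma norm_le_of_ae {u : M.Displacement ∞} {C : ℝ} (hC : 0 ≤ C)
    (h : ∀ᵐ x ∂M.μ, ‖u x‖ ≤ C) : ‖u‖ ≤ C := by
  have := hM.isFiniteMeasure
  simpa using Lp.norm_le_of_ae_bound hC h

lemma measurableSet_D : MeasurableSet M.D := hM.isOpen.measurableSet.diff hM.measurableSet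

lemma completeSpace_V : CompleteSpace M.V := by
  have h : (M.V : Set (M.Displacement ∞)) =
      (LpToLpRestrictCLM (Space n) (Space n) ℝ M.μ ∞ M.Ωd) ⁻¹' {0} := by
    ext v
    have h1 := LpToLpRestrictCLM_coeFn ℝ M.Ωd v
    rw [mem_preimage, mem_singleton_iff, Lp.eq_zero_iff_ae_eq_zero]
    change (∀ᵐ x ∂M.μ, x ∈ M.Ωd → v x = 0) ↔ _
    rw [← ae_restrict_iff' hM.measurableSet]
    constructor
    · intro h2
      filter_upwards [h1, h2] with x h3 h4
      rw [h3, h4, Pi.zero_apply]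
    · intro h2
      filter_upwards [h1, h2] with x h3 h4
      rw [← h3, h4, Pi.zero_apply]
  have hc : IsClosed (M.V : Set (M.Displacement ∞)) := by
    rw [h]
    exact isClosed_singleton.preimage (ContinuousLinearMap.continuous _)
  exact hc.completeSpace_coe

/-- Truncation to `D` of a function bounded there, as an element of `𝓥`. -/
lemma exists_mem_V {F : Space n → Space n} (hF : AEStronglyMeasurable F M.μ) {C : ℝ} (hC : 0 ≤ C)
    (hb : ∀ᵐ x ∂M.μ, x ∈ M.D → ‖F x‖ ≤ C) :
    ∃ v : M.V, ⇑(v : M.Displacement ∞) =ᵐ[M.μ] M.D.indicator F ∧ ‖v‖ ≤ C := by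
  have hb' : ∀ᵐ x ∂M.μ, ‖M.D.indicator F x‖ ≤ C := by
    filter_upwards [hb] with x hx
    by_cases hxD : x ∈ M.D
    · rw [indicator_of_mem hxD]; exact hx hxD
    · rw [indicator_of_notMem hxD]; simpa using hC
  have hmem : MemLp (M.D.indicator F) ∞ M.μ :=
    memLp_top_of_bound (hF.indicator hM.measurableSet_D) C hb'
  have hcoe := hmem.coeFn_toLp
  refine ⟨⟨hmem.toLp _, ?_⟩, hcoe, hM.norm_le_of_ae (u := hmem.toLp _) hC ?_⟩
  · filter_upwards [hcoe] with x hx hxd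
    rw [hx, indicator_of_notMem fun h : x ∈ M.D => h.2 hxd]
  · filter_upwards [hcoe, hb'] with x h1 h2
    rwa [h1]

omit hM in
lemma V_ext {v w : M.V}
    (h : ⇑(v : M.Displacement ∞) =ᵐ[M.μ] ⇑(w : M.Displacement ∞)) : v = w :=
  Subtype.ext (Lp.ext h)

/-- A bounded linear operator into `𝓥` from its values at almost every point of `D`. -/
lemma exists_clm (Φ : M.Displacement ∞ → Space n → Space n)
    (hm : ∀ w, AEStronglyMeasurable (Φ w) M.μ) {C : ℝ} (hC : 0 ≤ C)
    (hb : ∀ w, ∀ᵐ x ∂M.μ, x ∈ M.D → ‖Φ w x‖ ≤ C * ‖w‖)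
    (hadd : ∀ w w', ∀ᵐ x ∂M.μ, Φ (w + w') x = Φ w x + Φ w' x)
    (hsmul : ∀ (c : ℝ) w, ∀ᵐ x ∂M.μ, Φ (c • w) x = c • Φ w x) :
    ∃ T : M.Displacement ∞ →L[ℝ] M.V,
      ∀ w, ⇑(T w : M.Displacement ∞) =ᵐ[M.μ] M.D.indicator (Φ w) := by
  choose v hv hvn using fun w => hM.exists_mem_V (hm w) (mul_nonneg hC (norm_nonneg w)) (hb w)
  refine ⟨LinearMap.mkContinuous
    { toFun := v, map_add' := fun w w' => V_ext ?_, map_smul' := fun c w => V_ext ?_ } C hvn, hv⟩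
  · rw [Submodule.coe_add]
    filter_upwards [hv (w + w'), hv w, hv w', hadd w w',
      Lp.coeFn_add (v w : M.Displacement ∞) (v w')] with x h1 h2 h3 h4 h5
    rw [h1, h5, Pi.add_apply, h2, h3]
    by_cases hx : x ∈ M.D <;> simp [hx, h4]
  · rw [Submodule.coe_smul]
    filter_upwards [hv (c • w), hv w, hsmul c w,
      Lp.coeFn_smul c (v w : M.Displacement ∞)] with x h1 h2 h4 h5
    rw [h1, RingHom.id_apply, h5, Pi.smul_apply, h2]
    by_cases hx : x ∈ M.D <;> simp [hx, h4]

omit hM in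
lemma integrable_kernel_apply {k : Space n → Space n →L[ℝ] Space n} (hk : Integrable k)
    (w : M.Displacement ∞) (x : Space n) :
    Integrable (fun y => k (y - x) (w y)) M.μ ∧
      ‖∫ y, k (y - x) (w y) ∂M.μ‖ ≤ (∫ h, ‖k h‖) * ‖w‖ := by
  refine integrable_and_norm_integral_le ?_ hk.norm (fun _ => norm_nonneg _) (norm_nonneg w)
    (x := x) ?_
  · exact isBoundedBilinearMap_apply.continuous.comp_aestronglyMeasurable
      (((hk.comp_sub_right x).integrableOn (s := M.Ω)).aestronglyMeasurable.prodMk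
      (Lp.aestronglyMeasurable w))
  · filter_upwards [ae_norm_le_norm w] with y hy
    exact (ContinuousLinearMap.le_opNorm _ _).trans
      (mul_le_mul_of_nonneg_left hy (norm_nonneg _))

omit hM in
lemma kernel_add {k : Space n → Space n →L[ℝ] Space n} (hk : Integrable k)
    (w w' : M.Displacement ∞) (x : Space n) : ∫ y, k (y - x) ((w + w') y) ∂M.μ =
      ∫ y, k (y - x) (w y) ∂M.μ + ∫ y, k (y - x) (w' y) ∂M.μ := by
  rw [← integral_add (integrable_kernel_apply hk w x).1 (integrable_kernel_apply hk w' x).1]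
  refine integral_congr_ae ?_
  filter_upwards [Lp.coeFn_add w w'] with y hy
  rw [hy, Pi.add_apply, map_add]

omit hM in
lemma kernel_smul {k : Space n → Space n →L[ℝ] Space n} (c : ℝ)
    (w : M.Displacement ∞) (x : Space n) : ∫ y, k (y - x) ((c • w) y) ∂M.μ =
      c • ∫ y, k (y - x) (w y) ∂M.μ := by
  rw [← integral_smul]
  refine integral_congr_ae ?_
  filter_upwards [Lp.coeFn_smul c w] with y hy
  rw [hy, Pi.smul_apply, map_smul]

omit hM in
lemma exists_kernel_clm {k : Space n → Space n →L[ℝ] Space n} (hk : Integrable k)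
    (x : Space n) : ∃ P : M.Displacement ∞ →L[ℝ] Space n,
      ∀ w, P w = ∫ y, k (y - x) (w y) ∂M.μ :=
  ⟨LinearMap.mkContinuous
    { toFun := fun w => ∫ y, k (y - x) (w y) ∂M.μ
      map_add' := fun w w' => kernel_add hk w w' x
      map_smul' := fun c w => kernel_smul c w x }
    (∫ h, ‖k h‖) fun w => (integrable_kernel_apply hk w x).2, fun _ => rfl⟩

/-- An operator with integrable convolution kernel is compact on bounded functions. The kernel is
replaced by a uniformly continuous one, whose operator is determined up to a small error by its
values at finitely many points. -/
lemma isCompactOperator_of_kernel {k : Space n → Space n →L[ℝ] Space n} (hk : Integrable k)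
    {K : M.Displacement ∞ →L[ℝ] M.V} (hK : ∀ w, ⇑(K w : M.Displacement ∞) =ᵐ[M.μ]
      M.D.indicator fun x => ∫ y, k (y - x) (w y) ∂M.μ) : IsCompactOperator K := by
  have := hM.isFiniteMeasure
  have := hM.completeSpace_V
  refine isCompactOperator_of_le_finite (α := Space n) (G := Space n) K fun δ hδ => ?_
  obtain ⟨k', hk's, hk'δ, hk'c, hk'i⟩ :=
    hk.exists_hasCompactSupport_integral_sub_le (ε := δ / 2) (by positivity)
  choose P hP using fun x => exists_kernel_clm (M := M) hk'i x
  set m := M.μ.real univ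
  have hm : 0 ≤ m := measureReal_nonneg
  have hs : 0 < δ / (2 * (m + 1)) := by positivity
  obtain ⟨η, hη, hηs⟩ :=
    Metric.uniformContinuous_iff.1 (hk's.uniformContinuous_of_continuous hk'c) _ hs
  obtain ⟨t, -, htf, htc⟩ := Metric.finite_approx_of_totallyBounded
    (hM.isBounded.isCompact_closure.totallyBounded.subset subset_closure) η hη
  refine ⟨htf.toFinset, P, fun w c hc hw => ?_⟩
  have hC : 0 ≤ c + δ * ‖w‖ := by positivity
  refine hM.norm_le_of_ae (u := (K w : M.Displacement ∞)) hC ?_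
  filter_upwards [hK w, ae_restrict_mem hM.isOpen.measurableSet] with x hx hxΩ
  rw [hx]
  by_cases hxD : x ∈ M.D
  swap
  · rw [indicator_of_notMem hxD]; simpa using hC
  rw [indicator_of_mem hxD]
  obtain ⟨z, hz, hxz⟩ := mem_iUnion₂.1 (htc hxΩ)
  have h1 : ‖∫ y, (k - k') (y - x) (w y) ∂M.μ‖ ≤ δ / 2 * ‖w‖ :=
    (integrable_kernel_apply (hk.sub hk'i) w x).2.trans
      (mul_le_mul_of_nonneg_right hk'δ (norm_nonneg _))
  have h2 : ‖∫ y, (k' (y - x) (w y) - k' (y - z) (w y)) ∂M.μ‖ ≤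
      δ / (2 * (m + 1)) * ‖w‖ * m := by
    refine norm_integral_le_of_norm_le_const ?_
    filter_upwards [ae_norm_le_norm w] with y hy
    rw [← _root_.sub_apply]
    refine (ContinuousLinearMap.le_opNorm _ _).trans (mul_le_mul ?_ hy (norm_nonneg _) hs.le)
    rw [← dist_eq_norm]
    refine (hηs ?_).le
    rw [dist_sub_left]
    exact hxz
  have h3 : ‖P z w‖ ≤ c := hw z (htf.mem_toFinset.2 hz)
  have hsplit : ∫ y, k (y - x) (w y) ∂M.μ = ∫ y, (k - k') (y - x) (w y) ∂M.μ +
      ∫ y, (k' (y - x) (w y) - k' (y - z) (w y)) ∂M.μ + P z w := by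
    rw [hP, integral_sub (integrable_kernel_apply hk'i w x).1 (integrable_kernel_apply hk'i w z).1]
    simp only [Pi.sub_apply, _root_.sub_apply]
    rw [integral_sub (integrable_kernel_apply hk w x).1 (integrable_kernel_apply hk'i w x).1]
    abel
  have h4 : δ / (2 * (m + 1)) * ‖w‖ * m ≤ δ / 2 * ‖w‖ := by
    have : δ / (2 * (m + 1)) * m ≤ δ / 2 := by
      rw [div_mul_eq_mul_div, div_le_div_iff₀ (by positivity) two_pos]
      nlinarith
    nlinarith [norm_nonneg w]
  rw [hsplit]
  refine (norm_add₃_le).trans ?_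
  linarith

/-! ### The linearized operator -/

lemma stronglyMeasurable_integral_stiffness :
    StronglyMeasurable fun x => ∫ y, M.stiffness (y - x) ∂M.μ := by
  have := hM.isFiniteMeasure
  exact (hM.stronglyMeasurable_stiffness.comp_measurable
    (measurable_snd.sub measurable_fst)).integral_prod_right'
    (f := fun p : Space n × Space n => M.stiffness (p.2 - p.1))

lemma norm_integral_stiffness_le (hn : 2 ≤ n) (x : Space n) :
    ‖∫ y, M.stiffness (y - x) ∂M.μ‖ ≤ ∫ h, ‖M.stiffness h‖ := by
  have hk := hM.integrable_stiffness hn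
  simpa using (integrable_and_norm_integral_le (M := M) (x := x) (C := 1)
    (hk.comp_sub_right x).integrableOn.aestronglyMeasurable hk.norm (fun _ => norm_nonneg _)
    zero_le_one (by simp)).2

/-- The local part of the linearized operator: multiplication by the total stiffness. -/
lemma exists_local_clm (hn : 2 ≤ n) : ∃ N : M.Displacement ∞ →L[ℝ] M.V,
    ∀ w, ⇑(N w : M.Displacement ∞) =ᵐ[M.μ]
      M.D.indicator fun x => (∫ y, M.stiffness (y - x) ∂M.μ) (w x) := by
  refine hM.exists_clm (fun w x => (∫ y, M.stiffness (y - x) ∂M.μ) (w x)) (fun w => ?_)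
    (C := ∫ h, ‖M.stiffness h‖) (integral_nonneg fun _ => norm_nonneg _) (fun w => ?_)
    (fun w w' => ?_) (fun c w => ?_)
  · exact isBoundedBilinearMap_apply.continuous.comp_aestronglyMeasurable
      (hM.stronglyMeasurable_integral_stiffness.aestronglyMeasurable.prodMk
      (Lp.aestronglyMeasurable w))
  · filter_upwards [ae_norm_le_norm w] with x hx _
    exact (ContinuousLinearMap.le_opNorm _ _).trans (mul_le_mul
      (hM.norm_integral_stiffness_le hn x) hx (norm_nonneg _)
      (integral_nonneg fun _ => norm_nonneg _))
  · filter_upwards [Lp.coeFn_add w w'] with x hx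
    rw [hx, Pi.add_apply, map_add]
  · filter_upwards [Lp.coeFn_smul c w] with x hx
    rw [hx, Pi.smul_apply, map_smul]

/-- The nonlocal part of the linearized operator: convolution with the stiffness. -/
lemma exists_nonlocal_clm (hn : 2 ≤ n) : ∃ K : M.Displacement ∞ →L[ℝ] M.V,
    ∀ w, ⇑(K w : M.Displacement ∞) =ᵐ[M.μ]
      M.D.indicator fun x => ∫ y, M.stiffness (y - x) (w y) ∂M.μ := by
  have := hM.isFiniteMeasure
  have hk := hM.integrable_stiffness hn
  refine hM.exists_clm (fun w x => ∫ y, M.stiffness (y - x) (w y) ∂M.μ) (fun w => ?_)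
    (C := ∫ h, ‖M.stiffness h‖) (integral_nonneg fun _ => norm_nonneg _)
    (fun w => Eventually.of_forall fun x _ => (integrable_kernel_apply hk w x).2)
    (fun w w' => Eventually.of_forall fun x => kernel_add hk w w' x)
    (fun c w => Eventually.of_forall fun x => kernel_smul c w x)
  have h1 : StronglyMeasurable fun p : Space n × Space n => M.stiffness (p.2 - p.1) :=
    hM.stronglyMeasurable_stiffness.comp_measurable (measurable_snd.sub measurable_fst)
  have h2 : StronglyMeasurable fun p : Space n × Space n => w p.2 :=
    (Lp.stronglyMeasurable w).comp_measurable measurable_snd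
  exact (isBoundedBilinearMap_apply.continuous.comp_stronglyMeasurable
    (h1.prodMk h2)).integral_prod_right'.aestronglyMeasurable

/-- The linearized operator at `0` as a bounded operator; on `𝓥` it is an isomorphism, being a
compact perturbation of an invertible operator. -/
theorem exists_linearized (hn : 2 ≤ n) : ∃ (Λ : M.Displacement ∞ →L[ℝ] M.V) (A : M.V ≃L[ℝ] M.V),
    (∀ w, ⇑(Λ w : M.Displacement ∞) =ᵐ[M.μ] M.L' 0 w) ∧
      ∀ v : M.V, A v = Λ (v : M.Displacement ∞) := by
  have := hM.isFiniteMeasure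
  have := hM.completeSpace_V
  have hk := hM.integrable_stiffness hn
  obtain ⟨N, hN⟩ := hM.exists_local_clm hn
  obtain ⟨K, hK⟩ := hM.exists_nonlocal_clm hn
  have hΛ : ∀ w, ⇑(((2 : ℝ) • (N - K)) w : M.Displacement ∞) =ᵐ[M.μ] M.L' 0 w := by
    intro w
    have h0 : (((2 : ℝ) • (N - K)) w : M.Displacement ∞) =
      (2 : ℝ) • ((N w : M.Displacement ∞) - (K w : M.Displacement ∞)) := rfl
    rw [h0]
    filter_upwards [hN w, hK w, Lp.coeFn_smul (2 : ℝ) ((N w : M.Displacement ∞) - (K w : M.Displacement ∞)),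
      Lp.coeFn_sub (N w : M.Displacement ∞) (K w)] with x h1 h2 h3 h4
    rw [h3, Pi.smul_apply, h4, Pi.sub_apply, h1, h2]
    by_cases hx : x ∈ M.D
    · have hi := hk.comp_sub_right x |>.integrableOn (s := M.Ω)
      rw [indicator_of_mem hx, indicator_of_mem hx, L'_zero_apply _ hx, integral_smul,
        ContinuousLinearMap.integral_apply hi, ← smul_neg]
      simp only [map_sub]
      rw [integral_sub (integrable_kernel_apply hk w x).1 (hi.apply_continuousLinearMap _),
        neg_sub]
    · simp [L', hx]
  have hinj : ∀ v : M.V, N v = K v → v = 0 := by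
    intro v hv
    have hz : ((2 : ℝ) • (N - K)) (v : M.Displacement ∞) = 0 := by simp [hv]
    have h1 := hΛ v
    rw [hz] at h1
    have h2 := hM.ae_eq_zero_of_L'_zero hn (Lp.stronglyMeasurable (v : M.Displacement ∞))
      ((Lp.memLp (v : M.Displacement ∞)).mono_exponent le_top) v.2
      (h1.symm.trans (Lp.coeFn_zero _ _ _))
    exact V_ext (h2.trans (Lp.coeFn_zero _ _ _).symm)
  obtain ⟨c, hc, hcoer⟩ := hM.exists_coercive hn
  -- `τ` minimizes the bound `1 - 2 τ c + τ² b²` for `‖v - τ A v‖² / ‖v‖²`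
  set b : ℝ := (∫ h, ‖M.stiffness h‖) + c
  have hI0 : 0 ≤ ∫ h, ‖M.stiffness h‖ := integral_nonneg fun _ => norm_nonneg _
  have hb : 0 < b := by positivity
  have hcb : c ≤ b := le_add_of_nonneg_left hI0
  set τ : ℝ := c / b ^ 2
  have hτ : 0 < τ := by positivity
  set q : ℝ := Real.sqrt (1 - c ^ 2 / b ^ 2)
  have hq0 : 0 ≤ 1 - c ^ 2 / b ^ 2 := by
    rw [sub_nonneg, div_le_one (by positivity)]
    gcongr
  have hq1 : q < 1 := by
    rw [Real.sqrt_lt' one_pos]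
    have : 0 < c ^ 2 / b ^ 2 := by positivity
    linarith
  have hpoint : ∀ x ∈ M.D, ∀ v : Space n,
      ‖v - τ • (∫ y, M.stiffness (y - x) ∂M.μ) v‖ ≤ q * ‖v‖ := by
    intro x hx v
    set A := ∫ y, M.stiffness (y - x) ∂M.μ
    have h1 := hcoer x hx v
    have h2 : ‖A v‖ ≤ b * ‖v‖ := A.le_of_opNorm_le
      ((hM.norm_integral_stiffness_le hn x).trans (le_add_of_nonneg_right hc.le)) v
    refine (pow_le_pow_iff_left₀ (norm_nonneg _) (by positivity) two_ne_zero).1 ?_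
    rw [mul_pow, Real.sq_sqrt hq0, norm_sub_sq_real, real_inner_smul_right, norm_smul,
      Real.norm_of_nonneg hτ.le, real_inner_comm, mul_pow]
    have h3 : ‖A v‖ ^ 2 ≤ b ^ 2 * ‖v‖ ^ 2 := by
      rw [← mul_pow]; gcongr
    have h4 : τ ^ 2 * ‖A v‖ ^ 2 ≤ τ ^ 2 * (b ^ 2 * ‖v‖ ^ 2) := by gcongr
    have h5 : τ * (c * ‖v‖ ^ 2) ≤ τ * inner ℝ (A v) v := by gcongr
    have h6 : τ ^ 2 * b ^ 2 = c ^ 2 / b ^ 2 := by simp only [τ]; field_simp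
    have h7 : τ * c = c ^ 2 / b ^ 2 := by simp only [τ]; ring
    nlinarith
  have hnorm : ‖1 - τ • (N.comp M.V.subtypeL)‖ ≤ q := by
    refine ContinuousLinearMap.opNorm_le_bound _ (Real.sqrt_nonneg _) fun v => ?_
    have h0 : (((1 - τ • (N.comp M.V.subtypeL)) v : M.V) : M.Displacement ∞) =
      (v : M.Displacement ∞) - τ • (N v : M.Displacement ∞) := rfl
    refine hM.norm_le_of_ae
      (u := (((1 - τ • (N.comp M.V.subtypeL)) v : M.V) : M.Displacement ∞)) (by positivity) ?_
    rw [h0]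
    filter_upwards [hN v, Lp.coeFn_smul τ (N v : M.Displacement ∞),
      Lp.coeFn_sub (v : M.Displacement ∞) (τ • (N v : M.Displacement ∞)),
      ae_norm_le_norm (v : M.Displacement ∞), v.2,
      ae_restrict_mem hM.isOpen.measurableSet] with x h1 h2 h3 h4 h5 hxΩ
    rw [h3, Pi.sub_apply, h2, Pi.smul_apply, h1]
    by_cases hx : x ∈ M.D
    · rw [indicator_of_mem hx]
      exact (hpoint x hx _).trans (mul_le_mul_of_nonneg_left h4 (Real.sqrt_nonneg _))
    · have hxd : x ∈ M.Ωd := by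
        by_contra h
        exact hx ⟨hxΩ, h⟩
      rw [indicator_of_notMem hx, h5 hxd]
      simpa using mul_nonneg (Real.sqrt_nonneg _) (norm_nonneg _)
  have hunit : IsUnit ((2 : ℝ) • (N.comp M.V.subtypeL - K.comp M.V.subtypeL)) :=
    isUnit_smul_sub_of_isCompactOperator (K := K.comp M.V.subtypeL) ((hM.isCompactOperator_of_kernel hk hK).comp_clm M.V.subtypeL)
      hτ.ne' (hnorm.trans_lt hq1) hinj two_ne_zero
  obtain ⟨U, hU⟩ := hunit
  refine ⟨(2 : ℝ) • (N - K), ContinuousLinearEquiv.ofUnit U, hΛ, fun v => ?_⟩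
  change (U : M.V →L[ℝ] M.V) v = _
  rw [hU]
  rfl

end Admissible

/-! ### The nonlinear operator near the origin -/

variable (M) in
/-- The force density exerted on `x` by the bond to `y` in the intact body, up to sign. -/
def bondForce (u : Space n → Space n) (x y : Space n) : Space n :=
  (2 * (M.cutoffWeight (y - x) / Real.sqrt ‖y - x‖) * deriv M.g (scaledStrain u y x)) •
    unitVec (y - x)

lemma abs_scaledStrain_le {u : Space n → Space n} {m : ℝ} {x y : Space n} (hx : ‖u x‖ ≤ m)
    (hy : ‖u y‖ ≤ m) :
    |scaledStrain u y x| ≤ Real.sqrt ‖y - x‖ * ‖y - x‖⁻¹ * (2 * m) := by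
  rw [scaledStrain, strain_eq, ← mul_assoc, abs_mul,
    abs_of_nonneg (mul_nonneg (Real.sqrt_nonneg _) (inv_nonneg.2 (norm_nonneg _)))]
  refine mul_le_mul_of_nonneg_left ?_
    (mul_nonneg (Real.sqrt_nonneg _) (inv_nonneg.2 (norm_nonneg _)))
  refine (abs_real_inner_le_norm _ _).trans ?_
  have h1 := norm_sub_le (u y) (u x)
  have h2 := norm_unitVec_le (y - x)
  nlinarith [norm_nonneg (u y - u x)]

lemma scaledStrain_sub (u v : Space n → Space n) (y x : Space n) :
    scaledStrain u y x - scaledStrain v y x = scaledStrain (u - v) y x := by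
  simp only [scaledStrain, strain_eq, Pi.sub_apply, inner_sub_right]
  ring

namespace Admissible

variable (hM : M.Admissible)
include hM

lemma stronglyMeasurable_bondForce {u : Space n → Space n} (hu : StronglyMeasurable u) :
    StronglyMeasurable fun p : Space n × Space n => M.bondForce u p.1 p.2 := by
  refine Measurable.stronglyMeasurable ?_
  have h1 := hM.measurable_cutoffWeight
  have h2 := hu.measurable
  have h3 := measurable_unitVec (n := n)
  have h4 := measurable_deriv M.g
  unfold bondForce scaledStrain strain
  fun_prop

lemma norm_bondForce_le {u : Space n → Space n} {m : ℝ} {x y : Space n} (hx : ‖u x‖ ≤ m)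
    (hy : ‖u y‖ ≤ m) : ‖M.bondForce u x y‖ ≤
      M.cutoffWeight (y - x) * ‖y - x‖⁻¹ * (4 * iteratedDeriv 2 M.g 0 * m) := by
  have hm : 0 ≤ m := (norm_nonneg _).trans hx
  have hw := hM.cutoffWeight_nonneg (y - x)
  have hg := hM.potential.second_pos.le
  rcases eq_or_ne (y - x) 0 with h0 | h0
  · simp [bondForce, h0, unitVec]
  have hs : 0 < Real.sqrt ‖y - x‖ := Real.sqrt_pos.2 (norm_pos_iff.2 h0)
  rw [bondForce, norm_smul, norm_mul, Real.norm_of_nonneg (by positivity)]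
  have h1 : ‖deriv M.g (scaledStrain u y x)‖ ≤
      iteratedDeriv 2 M.g 0 * (Real.sqrt ‖y - x‖ * ‖y - x‖⁻¹ * (2 * m)) :=
    (hM.potential.abs_deriv_le _).trans
      (mul_le_mul_of_nonneg_left (abs_scaledStrain_le hx hy) hg)
  calc _ ≤ 2 * (M.cutoffWeight (y - x) / Real.sqrt ‖y - x‖) *
        (iteratedDeriv 2 M.g 0 * (Real.sqrt ‖y - x‖ * ‖y - x‖⁻¹ * (2 * m))) * 1 := by
        gcongr
        exact norm_unitVec_le _
    _ = _ := by field_simp; ring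

/-- The linearization error of a bond is quadratic in the displacements and has a kernel with the
singularity `|h|^{-3/2}`, still integrable in dimension two. -/
lemma exists_norm_bondForce_sub_le : ∃ C : ℝ, 0 ≤ C ∧
    ∀ (u v : Space n → Space n) (m r : ℝ) (x y : Space n), ‖u x‖ ≤ m → ‖u y‖ ≤ m → ‖v x‖ ≤ m →
      ‖v y‖ ≤ m → ‖u x - v x‖ ≤ r → ‖u y - v y‖ ≤ r →
      ‖M.bondForce u x y - M.bondForce v x y -
        (2 : ℝ) • M.stiffness (y - x) ((u y - v y) - (u x - v x))‖ ≤
      M.cutoffWeight (y - x) * ‖y - x‖ ^ (-(3 / 2) : ℝ) * (C * m * r) := by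
  obtain ⟨C, hC, hCg⟩ := hM.potential.exists_linearization_bound
  refine ⟨8 * C, by positivity, fun u v m r x y hux huy hvx hvy hx hy => ?_⟩
  have hm : 0 ≤ m := (norm_nonneg _).trans hux
  have hr : 0 ≤ r := (norm_nonneg _).trans hx
  have hw := hM.cutoffWeight_nonneg (y - x)
  rcases eq_or_ne (y - x) 0 with h0 | h0
  · simp [bondForce, stiffness, h0, unitVec]
  have hpos : 0 < ‖y - x‖ := norm_pos_iff.2 h0
  have hs : 0 < Real.sqrt ‖y - x‖ := Real.sqrt_pos.2 hpos
  have hlin : (2 : ℝ) • M.stiffness (y - x) ((u y - v y) - (u x - v x)) =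
      (2 * (M.cutoffWeight (y - x) / Real.sqrt ‖y - x‖) * (iteratedDeriv 2 M.g 0 *
        (scaledStrain u y x - scaledStrain v y x))) • unitVec (y - x) := by
    rw [stiffness_apply, smul_smul, scaledStrain_sub, scaledStrain, strain_eq]
    congr 1
    simp only [Pi.sub_apply]
    field_simp
  rw [hlin, bondForce, bondForce, ← sub_smul, ← sub_smul, ← mul_sub, ← mul_sub, norm_smul,
    norm_mul, Real.norm_of_nonneg (by positivity)]
  have h1 := hCg _ _ _ (abs_scaledStrain_le hux huy) (abs_scaledStrain_le hvx hvy)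
  have h2 : |scaledStrain u y x - scaledStrain v y x| ≤
      Real.sqrt ‖y - x‖ * ‖y - x‖⁻¹ * (2 * r) := by
    rw [scaledStrain_sub]
    exact abs_scaledStrain_le hx hy
  have h3 : ‖y - x‖ ^ (-(3 / 2) : ℝ) = Real.sqrt ‖y - x‖ * ‖y - x‖⁻¹ * ‖y - x‖⁻¹ := by
    rw [Real.sqrt_eq_rpow, ← Real.rpow_neg_one, ← Real.rpow_add hpos, ← Real.rpow_add hpos]
    norm_num
  calc _ ≤ 2 * (M.cutoffWeight (y - x) / Real.sqrt ‖y - x‖) *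
        (C * (Real.sqrt ‖y - x‖ * ‖y - x‖⁻¹ * (2 * m)) *
          (Real.sqrt ‖y - x‖ * ‖y - x‖⁻¹ * (2 * r))) * 1 := by
        gcongr
        · exact h1.trans (by gcongr)
        · exact norm_unitVec_le _
    _ = _ := by
        rw [h3]
        field_simp
        ring

omit hM in
lemma L_initialBonds_eq_bondForce (u : Space n → Space n) {x : Space n} (hx : x ∈ M.D) :
    M.L initialBonds u x = -∫ y, M.bondForce u x y ∂M.μ :=
  L_initialBonds_apply u hx

lemma integrable_bondForce (hn : 2 ≤ n) (u : M.Displacement ∞) :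
    ∀ᵐ x ∂M.μ, Integrable (M.bondForce u x) M.μ ∧ ‖∫ y, M.bondForce u x y ∂M.μ‖ ≤
      (∫ h, M.cutoffWeight h * ‖h‖⁻¹) * (4 * iteratedDeriv 2 M.g 0 * ‖u‖) := by
  have hg := hM.potential.second_pos.le
  filter_upwards [ae_norm_le_norm u] with x hx
  refine integrable_and_norm_integral_le (x := x)
    ((hM.stronglyMeasurable_bondForce (Lp.stronglyMeasurable u)).comp_measurable
      measurable_prodMk_left).aestronglyMeasurable (hM.integrable_cutoffWeight_mul_inv hn)
    (fun h => mul_nonneg (hM.cutoffWeight_nonneg h) (inv_nonneg.2 (norm_nonneg h)))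
    (by positivity) ?_
  filter_upwards [ae_norm_le_norm u] with y hy
  exact hM.norm_bondForce_le hx hy

/-- The force operator on bounded displacements, with values in `𝓥`, and its quadratic deviation
from the linearized operator. -/
theorem exists_forceOperator (hn : 2 ≤ n) {Λ : M.Displacement ∞ →L[ℝ] M.V}
    (hΛ : ∀ w, ⇑(Λ w : M.Displacement ∞) =ᵐ[M.μ] M.L' 0 w) :
    ∃ T : M.Displacement ∞ → M.V,
      (∀ u, ⇑(T u : M.Displacement ∞) =ᵐ[M.μ] M.L initialBonds u) ∧ T 0 = 0 ∧
      ∃ C : ℝ, 0 ≤ C ∧ ∀ (m : ℝ) (u v : M.Displacement ∞), ‖u‖ ≤ m → ‖v‖ ≤ m →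
        ‖T u - T v - Λ (u - v)‖ ≤ C * m * ‖u - v‖ := by
  have := hM.isFiniteMeasure
  have hg := hM.potential.second_pos.le
  have hI : 0 ≤ ∫ h : Space n, M.cutoffWeight h * ‖h‖⁻¹ := integral_nonneg fun h =>
    mul_nonneg (hM.cutoffWeight_nonneg h) (inv_nonneg.2 (norm_nonneg h))
  have hex : ∀ u : M.Displacement ∞, ∃ v : M.V,
      ⇑(v : M.Displacement ∞) =ᵐ[M.μ] M.L initialBonds u := by
    intro u
    have hm : AEStronglyMeasurable (fun x => -∫ y, M.bondForce u x y ∂M.μ) M.μ :=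
      (hM.stronglyMeasurable_bondForce (Lp.stronglyMeasurable u)
        ).integral_prod_right'.neg.aestronglyMeasurable
    obtain ⟨v, hv, -⟩ := hM.exists_mem_V hm
      (C := (∫ h, M.cutoffWeight h * ‖h‖⁻¹) * (4 * iteratedDeriv 2 M.g 0 * ‖u‖))
      (by positivity) (by
        filter_upwards [hM.integrable_bondForce hn u] with x hx _
        rw [norm_neg]; exact hx.2)
    refine ⟨v, hv.trans (Eventually.of_forall fun x => ?_)⟩
    by_cases hx : x ∈ M.D
    · rw [indicator_of_mem hx, L_initialBonds_eq_bondForce _ hx]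
    · simp [L, hx]
  choose T hT using hex
  refine ⟨T, hT, V_ext ?_, ?_⟩
  · have h0 : ⇑((0 : M.V) : M.Displacement ∞) =ᵐ[M.μ] 0 := Lp.coeFn_zero _ _ _
    filter_upwards [hT 0, h0, Lp.coeFn_zero (Space n) ∞ M.μ] with x h1 h2 h3
    rw [h1, h2]
    by_cases hx : x ∈ M.D
    · rw [L_initialBonds_eq_bondForce _ hx, Pi.zero_apply, neg_eq_zero]
      refine integral_eq_zero_of_ae ?_
      filter_upwards [Lp.coeFn_zero (Space n) ∞ M.μ] with y h4
      have : scaledStrain (⇑(0 : M.Displacement ∞)) y x = 0 := by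
        rw [scaledStrain, strain_eq, h3, h4]
        simp
      rw [bondForce, this, hM.potential.deriv_zero, mul_zero, zero_smul, Pi.zero_apply]
    · simp [L, hx]
  obtain ⟨C, hC, hCb⟩ := hM.exists_norm_bondForce_sub_le
  have hp : Integrable fun h : Space n => M.cutoffWeight h * ‖h‖ ^ (-(3 / 2) : ℝ) :=
    hM.integrable_cutoffWeight_mul_rpow hn (by norm_num)
  have hp0 : ∀ h : Space n, 0 ≤ M.cutoffWeight h * ‖h‖ ^ (-(3 / 2) : ℝ) := fun h =>
    mul_nonneg (hM.cutoffWeight_nonneg h) (Real.rpow_nonneg (norm_nonneg h) _)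
  have hpI : 0 ≤ ∫ h : Space n, M.cutoffWeight h * ‖h‖ ^ (-(3 / 2) : ℝ) := integral_nonneg hp0
  refine ⟨(∫ h : Space n, M.cutoffWeight h * ‖h‖ ^ (-(3 / 2) : ℝ)) * C, by positivity,
    fun m u v hu hv => ?_⟩
  have hm : 0 ≤ m := (norm_nonneg _).trans hu
  refine hM.norm_le_of_ae (u := ((T u - T v - Λ (u - v) : M.V) : M.Displacement ∞))
    (by positivity) ?_
  have h0 : ((T u - T v - Λ (u - v) : M.V) : M.Displacement ∞) =
    ((T u : M.Displacement ∞) - (T v : M.Displacement ∞)) -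
      (Λ (u - v) : M.Displacement ∞) := rfl
  rw [h0]
  have hsub : ∀ᵐ y ∂M.μ, (u - v : M.Displacement ∞) y = u y - v y := Lp.coeFn_sub u v
  filter_upwards [hT u, hT v, hΛ (u - v), hsub,
    Lp.coeFn_sub ((T u : M.Displacement ∞) - (T v : M.Displacement ∞))
      (Λ (u - v) : M.Displacement ∞),
    Lp.coeFn_sub (T u : M.Displacement ∞) (T v : M.Displacement ∞),
    ae_norm_le_norm u, ae_norm_le_norm v, ae_norm_le_norm (u - v),
    hM.integrable_bondForce hn u, hM.integrable_bondForce hn v]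
    with x h1 h2 h3 h4 h5 h6 h7 h8 h9 h10 h11
  rw [h5, Pi.sub_apply, h6, Pi.sub_apply, h1, h2, h3]
  by_cases hx : x ∈ M.D
  swap
  · simp only [L, L', indicator_of_notMem hx, sub_zero, norm_zero]
    positivity
  set w : M.Displacement ∞ := u - v
  have hk := hM.integrable_stiffness hn
  have hstiff : Integrable (fun y => (2 : ℝ) • M.stiffness (y - x) (w y - w x)) M.μ := by
    simp only [map_sub]
    exact ((integrable_kernel_apply hk w x).1.sub
      ((hk.comp_sub_right x |>.integrableOn (s := M.Ω)).apply_continuousLinearMap _)).smul (2 : ℝ)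
  have hdiff : Integrable (fun y => M.bondForce u x y - M.bondForce v x y) M.μ := h10.1.sub h11.1
  have hsum : M.L initialBonds u x - M.L initialBonds v x - M.L' 0 w x =
      -∫ y, (M.bondForce u x y - M.bondForce v x y -
        (2 : ℝ) • M.stiffness (y - x) (w y - w x)) ∂M.μ := by
    rw [L_initialBonds_eq_bondForce _ hx, L_initialBonds_eq_bondForce _ hx, L'_zero_apply _ hx,
      integral_sub hdiff hstiff, integral_sub h10.1 h11.1]
    abel
  rw [hsum, norm_neg]
  refine (integrable_and_norm_integral_le (x := x)
    (hdiff.sub hstiff).aestronglyMeasurable hp hp0 (C := C * m * ‖w‖)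
    (by positivity) ?_).2.trans_eq (by ring)
  filter_upwards [ae_norm_le_norm u, ae_norm_le_norm v, ae_norm_le_norm w, hsub]
    with y h12 h13 h14 h15
  have := hCb u v m ‖w‖ x y (h7.trans hu) (h12.trans hu) (h8.trans hv) (h13.trans hv)
    (by rw [← h4]; exact h9) (by rw [← h15]; exact h14)
  rwa [← h4, ← h15] at this

end Admissible

/-! ### Solvability of the load increment -/

/-- The local solution theory for an equation `T (v + U) = 0`, with load `U` ranging over a normed
space `E` containing the space `V` of unknowns, when `T` deviates quadratically from a linear map
that is invertible on `V`. The linearization error is a contraction on a ball whose radius does not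
depend on `U`. -/
lemma exists_unique_zero_of_quadratic_deviation {E : Type*} [NormedAddCommGroup E]
    [NormedSpace ℝ E] {V : Submodule ℝ E} [CompleteSpace V] {T : E → V} {Λ : E →L[ℝ] V}
    {A : V ≃L[ℝ] V} (hA : ∀ v : V, A v = Λ v) (hT0 : T 0 = 0) {C : ℝ} (hC : 0 ≤ C)
    (hT : ∀ (m : ℝ) (u v : E), ‖u‖ ≤ m → ‖v‖ ≤ m → ‖T u - T v - Λ (u - v)‖ ≤ C * m * ‖u - v‖) :
    ∃ R : ℝ, 0 < R ∧ ∃ δ : ℝ, 0 < δ ∧ ∀ U : E, ‖U‖ < δ → ∃ v : V, ‖v‖ < R ∧ T (v + U) = 0 ∧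
      ∀ v' : V, ‖v'‖ < R → T (v' + U) = 0 → v' = v := by
  -- a strictly positive bound for `A⁻¹`, also when `V` is trivial
  set N : NNReal := ‖(A.symm : V →L[ℝ] V)‖₊ + 1 with hN
  have hN0 : 0 < N := by positivity
  have hNr : (0 : ℝ) < N := hN0
  have hAN : ∀ v, ‖A.symm v‖ ≤ N * ‖v‖ := fun v =>
    (A.symm : V →L[ℝ] V).le_of_opNorm_le (by simp [hN]) v
  -- half of the largest error constant for which `A` plus the error remains invertible
  set c : NNReal := (2 * N)⁻¹ with hc
  set R : ℝ := 1 / (4 * N * (C + 1)) with hR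
  have hR0 : 0 < R := by positivity
  have hCR : C * (2 * R) ≤ c := by
    rw [hR, hc, NNReal.coe_inv, NNReal.coe_mul, NNReal.coe_ofNat]
    field_simp
    linarith
  set δ : ℝ := min R (R / (4 * N * (C * R + ‖Λ‖ + 1))) with hδ
  have hδ0 : 0 < δ := lt_min hR0 (by positivity)
  refine ⟨R, hR0, δ, hδ0, fun U hU => ?_⟩
  have hUR : ‖U‖ ≤ R := hU.le.trans (min_le_left _ _)
  have happrox : ApproximatesLinearOn (fun v : V => T (v + U)) (A : V →L[ℝ] V)
      (Metric.closedBall 0 R) c := by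
    intro v hv v' hv'
    rw [mem_closedBall_zero_iff] at hv hv'
    have h1 : ∀ z : V, ‖z‖ ≤ R → ‖(z : E) + U‖ ≤ 2 * R := fun z hz =>
      (norm_add_le _ _).trans (by have hz' : ‖(z : E)‖ ≤ R := hz; linarith)
    have h2 := hT _ _ _ (h1 v hv) (h1 v' hv')
    rw [add_sub_add_right_eq_sub, ← Submodule.coe_sub, ← hA] at h2
    exact h2.trans (mul_le_mul_of_nonneg_right hCR (norm_nonneg _))
  let inv : (A : V →L[ℝ] V).NonlinearRightInverse :=
    { toFun := A.symm, nnnorm := N, bound' := hAN, right_inv' := A.apply_symm_apply }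
  have hsurj := happrox.surjOn_closedBall_of_nonlinearRightInverse inv (ε := R / 2) (b := 0)
    (by positivity) (Metric.closedBall_subset_closedBall (by linarith))
  have h0 : (0 : V) ∈ Metric.closedBall (T (((0 : V) : E) + U))
      (((inv.nnnorm : ℝ)⁻¹ - c) * (R / 2)) := by
    have h1 : ‖T U‖ ≤ (C * R + ‖Λ‖ + 1) * ‖U‖ := by
      have h2 := hT R U 0 hUR (by simpa using hR0.le)
      rw [hT0, sub_zero, sub_zero] at h2
      have h3 := Λ.le_opNorm U
      have h4 := norm_le_norm_sub_add (T U) (Λ U)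
      nlinarith [norm_nonneg U]
    have h5 : ‖U‖ * (4 * N * (C * R + ‖Λ‖ + 1)) ≤ R :=
      (le_div_iff₀ (by positivity)).1 (hU.le.trans (min_le_right _ _))
    have h6 : ((inv.nnnorm : ℝ)⁻¹ - c) * (R / 2) = R / (4 * N) := by
      simp only [inv, hc, NNReal.coe_inv, NNReal.coe_mul, NNReal.coe_ofNat]
      field_simp
      norm_num
    rw [Submodule.coe_zero, zero_add, h6, mem_closedBall_iff_norm', sub_zero]
    refine h1.trans ?_
    rw [le_div_iff₀ (by positivity)]
    linarith
  obtain ⟨v, hv, hv0⟩ := hsurj h0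
  rw [mem_closedBall_zero_iff] at hv
  have hvR : ‖v‖ < R := by linarith
  refine ⟨v, hvR, hv0, fun v' hv' hv'0 => ?_⟩
  have h1 := happrox v' (by simpa using hv'.le) v (by simpa using hvR.le)
  have hv0' : T (v + U) = 0 := hv0
  simp only [hv'0, hv0', sub_self, zero_sub, norm_neg] at h1
  have h2 := hAN (A (v' - v))
  rw [A.symm_apply_apply] at h2
  have h3 : ‖v' - v‖ ≤ N * (c * ‖v' - v‖) :=
    h2.trans (mul_le_mul_of_nonneg_left h1 hNr.le)
  have h4 : (N : ℝ) * (c * ‖v' - v‖) = ‖v' - v‖ / 2 := by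
    simp only [hc, NNReal.coe_inv, NNReal.coe_mul, NNReal.coe_ofNat]
    field_simp
  rw [← sub_eq_zero, ← norm_le_zero_iff]
  linarith

/-- Deleting the broken bonds does not change the forces, since broken bonds carry none. -/
lemma L_remainingBonds (χ : Space n → Space n → ℝ) (u : Space n → Space n) :
    M.L (M.remainingBonds χ u) u = M.L χ u := by
  unfold L forceDensity
  congr 1
  ext1 x
  congr 2
  ext1 y
  by_cases h : M.Broken u y x
  · rw [h.1, mul_zero, mul_zero]
  · rw [remainingBonds, if_neg h]

lemma isEquilibrium_iff {T : M.Displacement ∞ → M.V}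
    (hT : ∀ u, ⇑(T u : M.Displacement ∞) =ᵐ[M.μ] M.L initialBonds u) (u : M.Displacement ∞) :
    M.IsEquilibrium initialBonds u ↔ T u = 0 := by
  have h0 : ⇑((0 : M.V) : M.Displacement ∞) =ᵐ[M.μ] 0 := Lp.coeFn_zero _ _ _
  constructor
  · intro h
    refine Admissible.V_ext ?_
    filter_upwards [hT u, h, h0] with x h1 h2 h3
    rw [h1, h3]
    by_cases hx : x ∈ M.D
    · exact h2 hx
    · exact indicator_of_notMem hx _
  · intro h
    have h1 := hT u
    rw [h] at h1
    filter_upwards [h1, h0] with x h2 h3 _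
    rw [← h2, h3, Pi.zero_apply]

namespace Admissible

variable (hM : M.Admissible)
include hM

lemma exists_mem_B_norm_lt (hn : 2 ≤ n) {δ : ℝ} (hδ : 0 < δ) : ∃ U ∈ M.B, U ≠ 0 ∧ ‖U‖ < δ := by
  have := hM.isFiniteMeasure
  have hpos : M.μ M.Ωd ≠ 0 := by
    rw [Measure.restrict_apply hM.measurableSet, inter_eq_left.2 hM.subset]
    exact hM.volume_pos.ne'
  let e : Space n := EuclideanSpace.single ⟨0, by omega⟩ (δ / 2)
  have he : ‖e‖ = δ / 2 := by simp [e, abs_of_pos hδ]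
  have hnorm : ‖indicatorConstLp ∞ hM.measurableSet (measure_ne_top M.μ _) e‖ = δ / 2 := by
    rw [norm_indicatorConstLp_top hpos, he]
  refine ⟨indicatorConstLp ∞ hM.measurableSet (measure_ne_top M.μ _) e, ?_, ?_, ?_⟩
  · have h := indicatorConstLp_coeFn (p := ∞) (hs := hM.measurableSet)
      (hμs := measure_ne_top M.μ _) (c := e)
    filter_upwards [h] with x hx hxD
    rw [hx, indicator_of_notMem hxD.2]
  · rw [← norm_pos_iff, hnorm]
    positivity
  · rw [hnorm]
    linarith

/-- The stability tensor at `0` is the matrix of the total stiffness. -/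
lemma stabilityTensor_zero_mulVec (hn : 2 ≤ n) (x : Space n) (v : Fin n → ℝ) :
    (M.stabilityTensor 0 x).mulVec v =
      ((∫ y, M.stiffness (y - x) ∂M.μ) (WithLp.toLp 2 v)).ofLp := by
  have hint : Integrable (fun y => M.stiffness (y - x)) M.μ :=
    ((hM.integrable_stiffness hn).comp_sub_right x).integrableOn
  have happ : ∀ (w : Space n) (i : Fin n), ((∫ y, M.stiffness (y - x) ∂M.μ) w) i =
      ∫ y, (M.stiffness (y - x) w) i ∂M.μ := fun w i => by
    rw [ContinuousLinearMap.integral_apply hint]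
    exact ((EuclideanSpace.proj (𝕜 := ℝ) i).integral_comp_comm
      (hint.apply_continuousLinearMap w)).symm
  have hentry : ∀ i j, M.stabilityTensor 0 x i j =
      ((∫ y, M.stiffness (y - x) ∂M.μ) (EuclideanSpace.single j 1)) i := by
    intro i j
    rw [happ, stabilityTensor, Matrix.of_apply]
    refine setIntegral_ball_inter (fun y hy => ?_) (fun y hy => ?_)
    · rw [stiffness_apply, cutoffWeight_sub hy, scaledStrain_zero]
      simp only [PiLp.smul_apply, smul_eq_mul, EuclideanSpace.inner_single_right]
      simp
      ring
    · simp [stiffness_apply, cutoffWeight_sub_of_notMem hy]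
  ext i
  have hv : WithLp.toLp 2 v = ∑ j, v j • EuclideanSpace.single j (1 : ℝ) := by
    ext k
    simp [Finset.sum_apply, Pi.single_apply]
  rw [hv, map_sum, Matrix.mulVec, dotProduct, WithLp.ofLp_sum, Finset.sum_apply]
  refine Finset.sum_congr rfl fun j _ => ?_
  rw [hentry, map_smul, PiLp.smul_apply, smul_eq_mul, mul_comm]

omit hM in
lemma stabilityTensor_transpose (u : Space n → Space n) (x : Space n) :
    (M.stabilityTensor u x).transpose = M.stabilityTensor u x := by
  ext i j
  simp only [stabilityTensor, Matrix.transpose_apply, Matrix.of_apply]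
  refine integral_congr_ae (Eventually.of_forall fun y => ?_)
  beta_reduce
  rw [mul_comm (unitVec (y - x) j)]

/-- Coercivity passes to the square of the symmetric stability tensor by Cauchy-Schwarz. -/
lemma exists_stabilityTensor_sq (hn : 2 ≤ n) : ∃ γ : ℝ, 0 < γ ∧ ∀ x ∈ M.D, ∀ v : Fin n → ℝ,
    v ≠ 0 → γ ^ 2 * (v ⬝ᵥ v) <
      Matrix.mulVec (M.stabilityTensor 0 x * M.stabilityTensor 0 x) v ⬝ᵥ v := by
  obtain ⟨c, hc, hcv⟩ := hM.exists_coercive hn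
  refine ⟨c / 2, by positivity, fun x hx v hv => ?_⟩
  set S := M.stabilityTensor 0 x
  set A := ∫ y, M.stiffness (y - x) ∂M.μ
  set v' : Space n := WithLp.toLp 2 v
  have hv' : 0 < ‖v'‖ := norm_pos_iff.2 fun h => hv <| by
    have := congrArg WithLp.ofLp h
    simpa [v'] using this
  have h1 : Matrix.mulVec (S * S) v ⬝ᵥ v = ‖A v'‖ ^ 2 := by
    rw [← Matrix.mulVec_mulVec, dotProduct_comm, Matrix.dotProduct_mulVec,
      ← Matrix.mulVec_transpose, stabilityTensor_transpose,
      hM.stabilityTensor_zero_mulVec hn, EuclideanSpace.real_norm_sq_eq]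
    simp [dotProduct, pow_two, A, v']
  have h2 : v ⬝ᵥ v = ‖v'‖ ^ 2 := by
    rw [EuclideanSpace.real_norm_sq_eq]
    simp [dotProduct, pow_two, v']
  have h3 : c * ‖v'‖ ≤ ‖A v'‖ := by
    have h4 := (hcv x hx v').trans (real_inner_le_norm (A v') v')
    rw [pow_two, ← mul_assoc] at h4
    exact le_of_mul_le_mul_right h4 hv'
  rw [h1, h2]
  calc (c / 2) ^ 2 * ‖v'‖ ^ 2 < (c * ‖v'‖) ^ 2 := by
        have : 0 < c ^ 2 * ‖v'‖ ^ 2 := by positivity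
        nlinarith
    _ ≤ ‖A v'‖ ^ 2 := by gcongr

end Admissible

end Model

end NonlocalFracture

end

theorem mainTheorem3 (n : ℕ) (hn : n = 2 ∨ n = 3) (M : Model n) (hM : M.Admissible) :
    -- `𝓛` maps `𝓥` to `𝓥`; its derivative `𝓛'[0]` is a bounded bijection of `𝓥` onto `𝓥`
    -- with bounded inverse
    (∃ (Lop : M.V → M.V) (A : M.V ≃L[ℝ] M.V),
      (∀ v : M.V,
        ⇑(Lop v : M.Displacement ∞) =ᵐ[M.μ] M.L Model.initialBonds ⇑(v : M.Displacement ∞)) ∧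
      (∀ w : M.V, ⇑(A w : M.Displacement ∞) =ᵐ[M.μ] M.L' 0 ⇑(w : M.Displacement ∞)) ∧
      HasFDerivAt Lop (A : M.V →L[ℝ] M.V) 0) ∧
    -- the hypotheses of the load increment step hold at `u⁰ = 0`
    M.IsEquilibrium Model.initialBonds 0 ∧
    (∃ γ : ℝ, 0 < γ ∧ ∀ x ∈ M.D, ∀ v : Fin n → ℝ, v ≠ 0 →
      γ ^ 2 * (v ⬝ᵥ v) <
        Matrix.mulVec (M.stabilityTensor 0 x * M.stabilityTensor 0 x) v ⬝ᵥ v) ∧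
    (∀ w : M.Displacement 2, w ∈ M.vanishingOn 2 M.Ωd → M.L' 0 ⇑w =ᵐ[M.μ] 0 → w = 0) ∧
    -- local uniqueness, and solvability of the first load step
    ∃ R : ℝ, 0 < R ∧
      (∀ u : M.Displacement ∞, u ∈ M.V → ‖u‖ < R →
        (M.IsEquilibrium Model.initialBonds u ↔ u = 0)) ∧
      ∃ δ : ℝ, 0 < δ ∧ (∃ U ∈ M.B, U ≠ 0 ∧ ‖U‖ < δ) ∧
        ∀ U ∈ M.B, ‖U‖ < δ → ∃ v ∈ M.V, ‖v‖ < R ∧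
          M.IsEquilibrium Model.initialBonds (v + U) ∧
          M.IsEquilibrium (M.remainingBonds Model.initialBonds ⇑(v + U)) (v + U) ∧
          ∀ v' ∈ M.V, ‖v'‖ < R → M.IsEquilibrium Model.initialBonds (v' + U) → v' = v := by
  have hn2 : 2 ≤ n := by omega
  have := hM.completeSpace_V
  obtain ⟨Λ, A, hΛ, hA⟩ := hM.exists_linearized hn2
  obtain ⟨T, hT, hT0, C, hC, hTC⟩ := hM.exists_forceOperator hn2 hΛ
  have hiff := Model.isEquilibrium_iff hT
  refine ⟨⟨fun v => T v, A, fun v => hT v, fun w => ?_, ?_⟩, (hiff 0).2 hT0,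
    hM.exists_stabilityTensor_sq hn2, fun w hw hL => ?_, ?_⟩
  · rw [hA]
    exact hΛ w
  · rw [hasFDerivAt_iff_isLittleO_nhds_zero]
    refine (Asymptotics.IsBigO.of_bound C (Eventually.of_forall fun v => ?_)).trans_isLittleO
      (Asymptotics.isLittleO_norm_pow_id one_lt_two)
    have h := hTC ‖v‖ v 0 le_rfl (by simp)
    rw [hT0, sub_zero, sub_zero, mul_assoc] at h
    change _ ≤ C * (‖v‖ * ‖v‖) at h
    rw [← pow_two] at h
    simp only [zero_add, Submodule.coe_zero, hT0, sub_zero, ContinuousLinearEquiv.coe_coe, hA,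
      norm_pow, norm_norm]
    exact h
  · exact Lp.ext ((hM.ae_eq_zero_of_L'_zero hn2 (Lp.stronglyMeasurable w) (Lp.memLp w) hw hL).trans
      (Lp.coeFn_zero _ _ _).symm)
  · obtain ⟨R, hR, δ, hδ, hsol⟩ :=
      Model.exists_unique_zero_of_quadratic_deviation hA hT0 hC hTC
    refine ⟨R, hR, fun u hu huR => ⟨fun h => ?_, fun h => h ▸ (hiff 0).2 hT0⟩, δ, hδ,
      hM.exists_mem_B_norm_lt hn2 hδ, fun U _ hU => ?_⟩
    · obtain ⟨v, -, -, huniq⟩ := hsol 0 (by simpa using hδ)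
      have h1 := huniq ⟨u, hu⟩ huR (by simpa using (hiff u).1 h)
      have h2 := huniq 0 (by simpa using hR) (by simpa using hT0)
      exact congrArg Subtype.val (h1.trans h2.symm)
    · obtain ⟨v, hvR, hv0, huniq⟩ := hsol U hU
      have heq := (hiff _).2 hv0
      refine ⟨v, v.2, hvR, heq, ?_, fun v' hv' hv'R h => ?_⟩
      · unfold Model.IsEquilibrium
        rw [Model.L_remainingBonds]
        exact heq
      · exact congrArg Subtype.val (huniq ⟨v', hv'⟩ hv'R ((hiff _).1 h))
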